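/- Let $(\Omega,\mathscr A,\mathbb P)$ be a probability space and let $(\xi_t)_{t=0,1,\dots}$ be a strictly stationary sequence of random elements of $M_1(\mathbb R)$, the space of Borel probability measures on $\mathbb R$ with the weak topology. Let $(X_\tau)_{\tau\ge 0}$ be a real-valued process, put $\Xi=\sigma(\xi_0,\xi_1,\dots)$, and suppose that $(\xi_t,X_\tau)$ is a cyclic-independent conjugate process, that is, $\mathbb P(X_\tau\in B\mid\Xi)=\xi_t(B)$ a.s. for all Borel $B$ and all $\tau\in[t,t+1)$, $t=0,1,\dots$, and, conditionally on $\Xi$, the path segments $(X_\tau:\tau\in[t,t+1))$, $t=0,1,\dots$, are independent. Let $\mathbb E\xi_0$ denote the barycenter of $\xi_0$, i.e. $(\mathbb E\xi_0)(B)=\mathbb E(\xi_0(B))$, and assume that $n^{-1}\sum_{t=1}^n\xi_t\to\mathbb E\xi_0$ in probability in $M_1(\mathbb R)$. Let $\mu$ be a finite Borel measure on $\mathbb R$ that is equivalent to Lebesgue measure on some interval containing the support of $\mathbb E\xi_0$. Put $F_t(x)=\xi_t(-\infty,x]$ and $C_k(x,y)=\operatorname{Cov}(F_0(x),F_k(y))$.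 Fix an integer $p\ge1$. For each $t$ let $X_{it}=X_{\tau_{it}}$, $i=1,\dots,q_t$ ($q_t\ge1$), be observations of the process at deterministic times $\tau_{it}\in[t,t+1)$. For $n>p$ put $$\widehat F_t(x)=\frac1{q_t}\sum_{i=1}^{q_t}\mathbb I_{[X_{it}\le x]},\qquad \widehat{\mathbb E}F_0=\frac1n\sum_{t=1}^n\widehat F_t,$$ $$\widehat C_k(x,y)=\frac1{n-p}\sum_{t=1}^{n-p}\big(\widehat F_t(x)-\widehat{\mathbb E}F_0(x)\big)\big(\widehat F_{t+k}(y)-\widehat{\mathbb E}F_0(y)\big).$$ Let $R^\mu$ and $\widehat R^\mu$ be the integral operators on $L^2(\mu)$ with kernels $$R_\mu(x,y)=\sum_{k=1}^p\int C_k(x,z)C_k(y,z)\,\mu(dz),\qquad \widehat R_\mu(x,y)=\sum_{k=1}^p\int \widehat C_k(x,z)\widehat C_k(y,z)\,\mu(dz),$$ and let $\theta_1\ge\theta_2\ge\cdots\ge0$ and $\widehat\theta_1\ge\widehat\theta_2\ge\cdots\ge0$ be their eigenvalues, repeated according to multiplicity, where each sequence contains zeros if and only if the operator has finite rank. The Hilbert–Schmidt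 norm $\|\cdot\|_{HS}$ of an integral operator is the $L^2(\mu\otimes\mu)$ norm of its kernel. Assume that for every $1\le k\le p$ $$\frac1n\sum_{t=1}^nF_t(x)F_{t+k}(y)=\mathbb E\big[F_0(x)F_k(y)\big]+o_{\mathbb P}(1)\quad\text{in }L^2(\mu\otimes\mu),$$ i.e. the $L^2(\mu\otimes\mu)$ norm of the difference tends to $0$ in probability. Then, as $n\to\infty$, (i) $\|\widehat R^\mu-R^\mu\|_{HS}=o_{\mathbb P}(1)$; (ii) $\sup_{j\in\mathbb N}|\widehat\theta_j-\theta_j|=o_{\mathbb P}(1)$. If moreover the nonzero eigenvalues of $R^\mu$ are all distinct, and $(\psi_j)_{j\in\mathbb N}$, $(\widehat\psi_j)_{j\in\mathbb N}$ are orthonormal sequences in $L^2(\mu)$ with $R^\mu\psi_j=\theta_j\psi_j$ and $\widehat R^\mu\widehat\psi_j=\widehat\theta_j\widehat\psi_j$, then (iii) $\|\widehat\psi_j-\psi_j\|_{L^2(\mu)}=o_{\mathbb P}(1)$ for each $j$ with $\theta_j>0$, provided that the sign of $\widehat\psi_j$ is chosen so that $\langle\widehat\psi_j,\psi_j\rangle\ge0$.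 -/

import Mathlib

open MeasureTheory ProbabilityTheory Filter Topology
open scoped ENNReal NNReal

namespace ConjugateProcess

/-! ### Convergence in probability -/

/-- `Y n = o_P(1)` for nonnegative (extended real) random quantities `Y n`. -/
def IsLittleOP {Ω : Type*} [MeasurableSpace Ω] (P : Measure Ω) (Y : ℕ → Ω → ℝ≥0∞) : Prop :=
  ∀ ε : ℝ≥0∞, 0 < ε → Tendsto (fun n => P {ω | ε ≤ Y n ω}) atTop (𝓝 0)

/-! ### Conjugate processes -/

section Model

variable {Ω : Type*} [MeasurableSpace Ω]

/-- The `σ`-field `Ξ = σ(ξ 0, ξ 1, …)` generated by the latent process. -/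
abbrev latentSigma (ξ : ℕ → Ω → ProbabilityMeasure ℝ) : MeasurableSpace Ω :=
  ⨆ t, MeasurableSpace.comap (ξ t) inferInstance

/-- The `σ`-field generated by the path of `X` over the `t`-th cycle `[t, t + 1)`. -/
abbrev cycleSigma (X : ℝ≥0 → Ω → ℝ) (t : ℕ) : MeasurableSpace Ω :=
  ⨆ τ ∈ Set.Ico (t : ℝ≥0) (t + 1), MeasurableSpace.comap (X τ) inferInstance

/-- `(ξ, X)` is a conjugate process: the `ξ t` are random elements of the space of Borel
probability measures on `ℝ`, the `X τ` are real random variables, and conditionally on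
`Ξ = σ(ξ 0, ξ 1, …)` the variable `X τ` has distribution `ξ t` whenever `τ ∈ [t, t + 1)`. -/
structure IsConjugateProcess (P : Measure Ω) (ξ : ℕ → Ω → ProbabilityMeasure ℝ)
    (X : ℝ≥0 → Ω → ℝ) : Prop where
  measurable_latent : ∀ t, Measurable (ξ t)
  measurable_obs : ∀ τ, Measurable (X τ)
  compat : ∀ (t : ℕ) (τ : ℝ≥0), τ ∈ Set.Ico (t : ℝ≥0) (t + 1) → ∀ B : Set ℝ, MeasurableSet B →
    P⟦X τ ⁻¹' B | latentSigma ξ⟧ =ᵐ[P] fun ω => (ξ t ω : Measure ℝ).real B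

/-- Strict stationarity of the latent sequence: all shifts of `(ξ t)` have the same law. -/
def IsStationary (P : Measure Ω) (ξ : ℕ → Ω → ProbabilityMeasure ℝ) : Prop :=
  ∀ m : ℕ, IdentDistrib (fun ω t => ξ (t + m) ω) (fun ω t => ξ t ω) P P

/-- Cyclic independence: conditionally on `Ξ`, the path segments of `X` over distinct cycles
are independent. -/
def IsCyclicIndependent (P : Measure Ω) (ξ : ℕ → Ω → ProbabilityMeasure ℝ)
    (X : ℝ≥0 → Ω → ℝ) : Prop :=
  ∀ (s : Finset ℕ) (A : ℕ → Set Ω), (∀ t ∈ s, MeasurableSet[cycleSigma X t] (A t)) →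
    P⟦⋂ t ∈ s, A t | latentSigma ξ⟧ =ᵐ[P] ∏ t ∈ s, P⟦A t | latentSigma ξ⟧

/-- The barycenter `E η` of a random probability measure `η`: `(E η)(B) = E (η(B))`. -/
noncomputable def barycenter (P : Measure Ω) (η : Ω → ProbabilityMeasure ℝ) : Measure ℝ :=
  P.bind fun ω => (η ω : Measure ℝ)

/-- Ergodicity in probability: `n⁻¹ ∑_{t=1}^n ξ t → E ξ 0` in probability, in the space of
probability measures with the weak topology (metrized by the Lévy–Prokhorov metric). -/
def IsErgodicInProbability (P : Measure Ω) (ξ : ℕ → Ω → ProbabilityMeasure ℝ) : Prop :=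
  IsLittleOP P fun n ω =>
    levyProkhorovEDist ((n : ℝ≥0∞)⁻¹ • ∑ t ∈ Finset.Icc 1 n, (ξ t ω : Measure ℝ))
      (barycenter P (ξ 0))

/-- The (finite) measure `μ` is a diffraction of `(ξ t)`: it is equivalent to Lebesgue measure
on some interval containing the support of `E ξ 0`. -/
def IsDiffraction (P : Measure Ω) (ξ : ℕ → Ω → ProbabilityMeasure ℝ) (μ : Measure ℝ) : Prop :=
  ∃ I : Set ℝ, I.OrdConnected ∧ (barycenter P (ξ 0)).support ⊆ I ∧
    μ ≪ volume.restrict I ∧ volume.restrict I ≪ μ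

/-- The latent distribution functions `F_t(x) = ξ_t(-∞, x]`. -/
noncomputable def latentCDF (ξ : ℕ → Ω → ProbabilityMeasure ℝ) (t : ℕ) (ω : Ω) (x : ℝ) : ℝ :=
  (ξ t ω : Measure ℝ).real (Set.Iic x)

/-- The lag-`k` autocovariance function `C_k(x, y) = Cov(F_0(x), F_k(y))`. -/
noncomputable def autocov (P : Measure Ω) (ξ : ℕ → Ω → ProbabilityMeasure ℝ) (k : ℕ)
    (x y : ℝ) : ℝ :=
  cov[fun ω => latentCDF ξ 0 ω x, fun ω => latentCDF ξ k ω y; P]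

/-! ### Sampling and empirical quantities -/

/-- A sampling scheme: in each cycle `t` the process is observed at `q t ≥ 1` times
`time t i ∈ [t, t + 1)`. -/
structure SamplingScheme where
  q : ℕ → ℕ
  q_pos : ∀ t, 0 < q t
  time : ∀ t : ℕ, Fin (q t) → ℝ≥0
  time_mem : ∀ (t : ℕ) (i : Fin (q t)), time t i ∈ Set.Ico (t : ℝ≥0) (t + 1)

/-- The empirical distribution function `F̂_t` of the observations in cycle `t`. -/
noncomputable def empCDF (X : ℝ≥0 → Ω → ℝ) (S : SamplingScheme) (t : ℕ) (ω : Ω) (x : ℝ) : ℝ :=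
  (S.q t : ℝ)⁻¹ * ∑ i, (Set.Iic x).indicator (fun _ => (1 : ℝ)) (X (S.time t i) ω)

/-- The estimated mean function `n⁻¹ ∑_{t=1}^n F̂_t`. -/
noncomputable def empMean (X : ℝ≥0 → Ω → ℝ) (S : SamplingScheme) (n : ℕ) (ω : Ω) (x : ℝ) : ℝ :=
  (n : ℝ)⁻¹ * ∑ t ∈ Finset.Icc 1 n, empCDF X S t ω x

/-- The estimated lag-`k` autocovariance function `Ĉ_k(x, y)` (meaningful for `p < n`). -/
noncomputable def empAutocov (X : ℝ≥0 → Ω → ℝ) (S : SamplingScheme) (p n : ℕ) (ω : Ω) (k : ℕ)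
    (x y : ℝ) : ℝ :=
  ((n : ℝ) - p)⁻¹ * ∑ t ∈ Finset.Icc 1 (n - p),
    (empCDF X S t ω x - empMean X S n ω x) * (empCDF X S (t + k) ω y - empMean X S n ω y)

end Model

/-! ### Integral operators on `L²(μ)` -/

section IntegralOperator

variable {μ : Measure ℝ} [IsFiniteMeasure μ] {K : ℝ → ℝ → ℝ}

theorem eLpNorm_integral_mul_le (hK : MemLp (Function.uncurry K) 2 (μ.prod μ))
    {f : ℝ → ℝ} (hf : MemLp f 2 μ) :
    eLpNorm (fun x => ∫ y, K x y * f y ∂μ) 2 μ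
      ≤ eLpNorm (Function.uncurry K) 2 (μ.prod μ) * eLpNorm f 2 μ := by
  have key : ∀ᵐ x ∂μ, ‖∫ y, K x y * f y ∂μ‖ₑ ^ (2 : ℝ)
      ≤ (∫⁻ y, ‖K x y‖ₑ ^ (2 : ℝ) ∂μ) * ∫⁻ y, ‖f y‖ₑ ^ (2 : ℝ) ∂μ := by
    filter_upwards [hK.1.prodMk_left] with x hx
    have h1 : ‖∫ y, K x y * f y ∂μ‖ₑ ≤ ∫⁻ y, ((fun y => ‖K x y‖ₑ) * fun y => ‖f y‖ₑ) y ∂μ := by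
      refine (enorm_integral_le_lintegral_enorm _).trans (le_of_eq ?_)
      simp
    have h2 := h1.trans (ENNReal.lintegral_mul_le_Lp_mul_Lq μ
      (Real.HolderConjugate.two_two) hx.enorm hf.1.enorm)
    refine (ENNReal.rpow_le_rpow h2 (by norm_num)).trans (le_of_eq ?_)
    rw [ENNReal.mul_rpow_of_nonneg _ _ (by norm_num), ← ENNReal.rpow_mul, ← ENNReal.rpow_mul]
    norm_num
  simp only [eLpNorm_eq_lintegral_rpow_enorm_toReal (p := 2) (by norm_num) (by norm_num),
    ENNReal.toReal_ofNat]
  rw [← ENNReal.mul_rpow_of_nonneg _ _ (by norm_num)]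
  refine ENNReal.rpow_le_rpow ((lintegral_mono_ae key).trans ?_) (by norm_num)
  have hm : AEMeasurable (fun z : ℝ × ℝ => ‖Function.uncurry K z‖ₑ ^ (2 : ℝ)) (μ.prod μ) :=
    hK.1.enorm.pow_const _
  rw [lintegral_prod _ hm, ← lintegral_mul_const'' _ hm.lintegral_prod_right']
  exact le_rfl

theorem memLp_integral_mul (hK : MemLp (Function.uncurry K) 2 (μ.prod μ)) {f : ℝ → ℝ}
    (hf : MemLp f 2 μ) : MemLp (fun x => ∫ y, K x y * f y ∂μ) 2 μ := by
  refine ⟨?_, (eLpNorm_integral_mul_le hK hf).trans_lt (ENNReal.mul_lt_top hK.2 hf.2)⟩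
  have h : AEStronglyMeasurable (fun z : ℝ × ℝ => Function.uncurry K z * f z.2) (μ.prod μ) :=
    hK.1.mul hf.1.comp_snd
  exact h.integral_prod_right'

theorem ae_memLp_section (hK : MemLp (Function.uncurry K) 2 (μ.prod μ)) :
    ∀ᵐ x ∂μ, MemLp (K x) 2 μ := by
  have h := ((memLp_two_iff_integrable_sq hK.1).1 hK).prod_right_ae
  filter_upwards [hK.1.prodMk_left, h] with x hx hx'
  exact (memLp_two_iff_integrable_sq hx).2 hx'

theorem norm_toLp_integral_mul_le (hK : MemLp (Function.uncurry K) 2 (μ.prod μ))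
    (f : Lp ℝ 2 μ) :
    ‖(memLp_integral_mul hK (Lp.memLp f)).toLp (fun x => ∫ y, K x y * f y ∂μ)‖
      ≤ (eLpNorm (Function.uncurry K) 2 (μ.prod μ)).toReal * ‖f‖ := by
  rw [Lp.norm_toLp, Lp.norm_def, ← ENNReal.toReal_mul]
  exact ENNReal.toReal_mono (ENNReal.mul_ne_top hK.2.ne (Lp.memLp f).2.ne)
    (eLpNorm_integral_mul_le hK (Lp.memLp f))

/-- The integral operator `f ↦ ∫ K(·, y) f(y) μ(dy)` on `L²(μ)` with kernel
`K ∈ L²(μ ⊗ μ)`. -/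
noncomputable def integralOp (hK : MemLp (Function.uncurry K) 2 (μ.prod μ)) :
    Lp ℝ 2 μ →L[ℝ] Lp ℝ 2 μ :=
  LinearMap.mkContinuous
    { toFun := fun f => (memLp_integral_mul hK (Lp.memLp f)).toLp
        (fun x => ∫ y, K x y * f y ∂μ)
      map_add' := fun f g => by
        rw [← MemLp.toLp_add]
        refine MemLp.toLp_congr _ _ ?_
        filter_upwards [ae_memLp_section hK] with x hx
        refine Eq.trans ?_ (integral_add' (hx.integrable_mul (Lp.memLp f))
          (hx.integrable_mul (Lp.memLp g)))
        refine integral_congr_ae ?_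
        filter_upwards [Lp.coeFn_add f g] with y hy
        simp only [hy, Pi.add_apply, mul_add]
      map_smul' := fun c f => by
        rw [RingHom.id_apply, ← MemLp.toLp_const_smul]
        refine MemLp.toLp_congr _ _ (Eventually.of_forall fun x => ?_)
        simp only [Pi.smul_apply, smul_eq_mul]
        rw [← integral_const_mul]
        refine integral_congr_ae ?_
        filter_upwards [Lp.coeFn_smul c f] with y hy
        simp [hy, mul_left_comm] }
    (eLpNorm (Function.uncurry K) 2 (μ.prod μ)).toReal
    (fun f => norm_toLp_integral_mul_le hK f)

/-- The Hilbert–Schmidt norm of the integral operator on `L²(μ)` with kernel `K`, that is, the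
`L²(μ ⊗ μ)` norm of `K`. -/
noncomputable def hsNorm (μ : Measure ℝ) (K : ℝ → ℝ → ℝ) : ℝ≥0∞ :=
  eLpNorm (Function.uncurry K) 2 (μ.prod μ)

/-- The kernel `∑_{k=1}^p ∫ C_k(x, z) C_k(y, z) μ(dz)` built from lagged kernels `C_k`. -/
noncomputable def lagKernel (μ : Measure ℝ) (p : ℕ) (C : ℕ → ℝ → ℝ → ℝ) (x y : ℝ) : ℝ :=
  ∑ k ∈ Finset.Icc 1 p, ∫ z, C k x z * C k y z ∂μ

theorem memLp_lagKernel (p : ℕ) {C : ℕ → ℝ → ℝ → ℝ}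
    (hC : ∀ k, Measurable (Function.uncurry (C k))) (hb : ∀ k, ∃ M : ℝ, ∀ x y, |C k x y| ≤ M) :
    MemLp (Function.uncurry (lagKernel μ p C)) 2 (μ.prod μ) := by
  have h : ∀ k ∈ Finset.Icc 1 p,
      MemLp (fun z : ℝ × ℝ => ∫ w, C k z.1 w * C k z.2 w ∂μ) 2 (μ.prod μ) := by
    intro k _
    obtain ⟨M, hM⟩ := hb k
    have hm : Measurable fun u : (ℝ × ℝ) × ℝ => C k u.1.1 u.2 * C k u.1.2 u.2 :=
      ((hC k).comp ((measurable_fst.comp measurable_fst).prodMk measurable_snd)).mul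
        ((hC k).comp ((measurable_snd.comp measurable_fst).prodMk measurable_snd))
    refine MemLp.of_bound hm.stronglyMeasurable.integral_prod_right'.aestronglyMeasurable
      (M * M * μ.real Set.univ) (Eventually.of_forall fun z => ?_)
    refine norm_integral_le_of_norm_le_const (Eventually.of_forall fun w => ?_)
    rw [Real.norm_eq_abs, abs_mul]
    exact mul_le_mul (hM _ _) (hM _ _) (abs_nonneg _) ((abs_nonneg _).trans (hM z.1 w))
  exact memLp_finsetSum (Finset.Icc 1 p) h

end IntegralOperator

/-! ### Measurability and bounds for the kernels -/

theorem latentCDF_mem {Ω : Type*} (ξ : ℕ → Ω → ProbabilityMeasure ℝ) (t : ℕ) (ω : Ω) (x : ℝ) : latentCDF ξ t ω x ∈ Set.Icc (0 : ℝ) 1 :=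
  ⟨measureReal_nonneg, measureReal_le_one⟩

section Empirical

variable {Ω : Type*}

theorem measurable_empCDF (X : ℝ≥0 → Ω → ℝ) (S : SamplingScheme) (t : ℕ) (ω : Ω) :
    Measurable (empCDF X S t ω) := by
  refine Measurable.const_mul (Finset.measurable_sum _ fun i _ => ?_) _
  exact Measurable.ite (measurableSet_le measurable_const measurable_id)
    measurable_const measurable_const

theorem abs_empCDF_le (X : ℝ≥0 → Ω → ℝ) (S : SamplingScheme) (t : ℕ) (ω : Ω) :
    ∃ M : ℝ, ∀ x, |empCDF X S t ω x| ≤ M := by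
  refine ⟨|(S.q t : ℝ)⁻¹| * ∑ _i : Fin (S.q t), 1, fun x => ?_⟩
  rw [empCDF, abs_mul]
  refine mul_le_mul_of_nonneg_left ((Finset.abs_sum_le_sum_abs _ _).trans
    (Finset.sum_le_sum fun i _ => ?_)) (abs_nonneg _)
  by_cases hx : X (S.time t i) ω ∈ Set.Iic x <;> simp [Set.indicator, hx]

theorem measurable_empMean (X : ℝ≥0 → Ω → ℝ) (S : SamplingScheme) (n : ℕ) (ω : Ω) :
    Measurable (empMean X S n ω) :=
  Measurable.const_mul (Finset.measurable_sum _ fun t _ => measurable_empCDF X S t ω) _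

theorem abs_empMean_le (X : ℝ≥0 → Ω → ℝ) (S : SamplingScheme) (n : ℕ) (ω : Ω) :
    ∃ M : ℝ, ∀ x, |empMean X S n ω x| ≤ M := by
  choose M hM using fun t => abs_empCDF_le X S t ω
  refine ⟨|(n : ℝ)⁻¹| * ∑ t ∈ Finset.Icc 1 n, M t, fun x => ?_⟩
  rw [empMean, abs_mul]
  exact mul_le_mul_of_nonneg_left ((Finset.abs_sum_le_sum_abs _ _).trans
    (Finset.sum_le_sum fun t _ => hM t x)) (abs_nonneg _)

theorem measurable_empAutocov (X : ℝ≥0 → Ω → ℝ) (S : SamplingScheme) (p n : ℕ) (ω : Ω)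
    (k : ℕ) : Measurable (Function.uncurry (empAutocov X S p n ω k)) := by
  refine Measurable.const_mul (Finset.measurable_sum _ fun t _ => ?_) _
  exact (((measurable_empCDF X S t ω).sub (measurable_empMean X S n ω)).comp measurable_fst).mul
    (((measurable_empCDF X S (t + k) ω).sub (measurable_empMean X S n ω)).comp measurable_snd)

theorem abs_empAutocov_le (X : ℝ≥0 → Ω → ℝ) (S : SamplingScheme) (p n : ℕ) (ω : Ω) (k : ℕ) :
    ∃ M : ℝ, ∀ x y, |empAutocov X S p n ω k x y| ≤ M := by
  choose M hM using fun t => abs_empCDF_le X S t ω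
  obtain ⟨N, hN⟩ := abs_empMean_le X S n ω
  refine ⟨|((n : ℝ) - p)⁻¹| * ∑ t ∈ Finset.Icc 1 (n - p), (M t + N) * (M (t + k) + N),
    fun x y => ?_⟩
  rw [empAutocov, abs_mul]
  refine mul_le_mul_of_nonneg_left ((Finset.abs_sum_le_sum_abs _ _).trans
    (Finset.sum_le_sum fun t _ => ?_)) (abs_nonneg _)
  have h : ∀ s z, |empCDF X S s ω z - empMean X S n ω z| ≤ M s + N := fun s z =>
    (abs_sub _ _).trans (add_le_add (hM s z) (hN z))
  rw [abs_mul]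
  exact mul_le_mul (h _ _) (h _ _) (abs_nonneg _) ((abs_nonneg _).trans (h t x))

end Empirical

/-! ### The operators `R^μ` and `R̂^μ` -/

section Operators

variable {Ω : Type*} [MeasurableSpace Ω] {ξ : ℕ → Ω → ProbabilityMeasure ℝ}

theorem measurable_latentCDF (hξ : ∀ t, Measurable (ξ t)) (t : ℕ) :
    Measurable fun u : Ω × ℝ => latentCDF ξ t u.1 u.2 := by
  let κ : Kernel (Ω × ℝ) ℝ := ⟨fun u => (ξ t u.1 : Measure ℝ),
    measurable_subtype_coe.comp ((hξ t).comp measurable_fst)⟩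
  have : IsMarkovKernel κ := ⟨fun u => (ξ t u.1).2⟩
  have hs : MeasurableSet {v : (Ω × ℝ) × ℝ | v.2 ≤ v.1.2} :=
    measurableSet_le measurable_snd (measurable_snd.comp measurable_fst)
  exact (Kernel.measurable_kernel_prodMk_left (κ := κ) hs).ennreal_toReal

theorem measurable_autocov (P : Measure Ω) [IsProbabilityMeasure P]
    (hξ : ∀ t, Measurable (ξ t)) (k : ℕ) : Measurable (Function.uncurry (autocov P ξ k)) := by
  have hmean : ∀ t, Measurable fun x : ℝ => ∫ ω, latentCDF ξ t ω x ∂P := fun t =>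
    (measurable_latentCDF hξ t).stronglyMeasurable.integral_prod_left'.measurable
  have hF : ∀ t (g : ℝ × ℝ → ℝ), Measurable g →
      Measurable fun u : (ℝ × ℝ) × Ω => latentCDF ξ t u.2 (g u.1) -
        ∫ ω, latentCDF ξ t ω (g u.1) ∂P := fun t g hg =>
    ((measurable_latentCDF hξ t).comp
      (measurable_snd.prodMk (hg.comp measurable_fst))).sub
      ((hmean t).comp (hg.comp measurable_fst))
  exact ((hF 0 _ measurable_fst).mul
    (hF k _ measurable_snd)).stronglyMeasurable.integral_prod_right'.measurable

theorem abs_autocov_le (P : Measure Ω) [IsProbabilityMeasure P] (k : ℕ) (x y : ℝ) :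
    |autocov P ξ k x y| ≤ 1 := by
  have h : ∀ t ω z, |latentCDF ξ t ω z - ∫ ω', latentCDF ξ t ω' z ∂P| ≤ 1 := by
    intro t ω z
    have h0 : 0 ≤ ∫ ω', latentCDF ξ t ω' z ∂P := integral_nonneg fun ω' => (latentCDF_mem ξ t ω' z).1
    have h1 : ∫ ω', latentCDF ξ t ω' z ∂P ≤ 1 := by
      have := norm_integral_le_of_norm_le_const (μ := P) (f := fun ω' => latentCDF ξ t ω' z)
        (C := 1) (Eventually.of_forall fun ω' => by
          rw [Real.norm_eq_abs, abs_of_nonneg (latentCDF_mem ξ t ω' z).1]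
          exact (latentCDF_mem ξ t ω' z).2)
      simpa using (le_abs_self _).trans this
    have h2 := latentCDF_mem ξ t ω z
    rw [abs_le]
    constructor <;> linarith [h2.1, h2.2]
  have := norm_integral_le_of_norm_le_const (μ := P) (C := 1)
    (f := fun ω => (latentCDF ξ 0 ω x - ∫ ω', latentCDF ξ 0 ω' x ∂P) *
      (latentCDF ξ k ω y - ∫ ω', latentCDF ξ k ω' y ∂P))
    (Eventually.of_forall fun ω => by
      rw [Real.norm_eq_abs, abs_mul]
      exact mul_le_one₀ (h _ _ _) (abs_nonneg _) (h _ _ _))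
  simpa [autocov, covariance] using this

/-- The operator `R^μ` on `L²(μ)`, with kernel `∑_{k=1}^p ∫ C_k(x, z) C_k(y, z) μ(dz)`. -/
noncomputable def dynOp (P : Measure Ω) [IsProbabilityMeasure P] (hξ : ∀ t, Measurable (ξ t))
    (μ : Measure ℝ) [IsFiniteMeasure μ] (p : ℕ) : Lp ℝ 2 μ →L[ℝ] Lp ℝ 2 μ :=
  integralOp (memLp_lagKernel (μ := μ) p (measurable_autocov P hξ)
    fun k => ⟨1, abs_autocov_le P k⟩)

/-- The estimator `R̂^μ`, with kernel `∑_{k=1}^p ∫ Ĉ_k(x, z) Ĉ_k(y, z) μ(dz)`, computed from the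
sample of cycles `1, …, n` at the outcome `ω`. -/
noncomputable def empDynOp (X : ℝ≥0 → Ω → ℝ) (S : SamplingScheme) (μ : Measure ℝ)
    [IsFiniteMeasure μ] (p n : ℕ) (ω : Ω) : Lp ℝ 2 μ →L[ℝ] Lp ℝ 2 μ :=
  integralOp (memLp_lagKernel (μ := μ) p (measurable_empAutocov X S p n ω)
    (abs_empAutocov_le X S p n ω))

end Operators

/-! ### Eigenvalues and eigenfunctions -/

section Spectrum

variable {H : Type*} [NormedAddCommGroup H] [InnerProductSpace ℝ H]

/-- For a compact positive operator `T`, the non-increasing sequence (indexed from `0`) of its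
eigenvalues, repeated according to multiplicity and continued by zeros precisely when `T` has
finite rank. The `j`-th term is the largest `s > 0` such that the eigenvalues `≥ s` have total
multiplicity at least `j + 1`, and is `0` (the supremum of the empty set) if there is no
such `s`. -/
noncomputable def eigenvalueSeq (T : H →L[ℝ] H) (j : ℕ) : ℝ :=
  sSup {s : ℝ | 0 < s ∧ ((j + 1 : ℕ) : Cardinal) ≤
    Module.rank ℝ ↥(⨆ a ∈ Set.Ici s, Module.End.eigenspace (T : H →ₗ[ℝ] H) a)}

/-- `ψ` is an orthonormal sequence of eigenvectors belonging to the eigenvalue sequence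
of `T`. -/
def IsEigenSystem (T : H →L[ℝ] H) (ψ : ℕ → H) : Prop :=
  Orthonormal ℝ ψ ∧ ∀ j, T (ψ j) = eigenvalueSeq T j • ψ j

end Spectrum

end ConjugateProcess

namespace ConjugateProcess

/-! ### Eigenvalues and eigenvectors of compact symmetric operators under perturbation -/

section SpectralPerturbation

variable {H : Type*} [NormedAddCommGroup H] [InnerProductSpace ℝ H]

/-! Everything reduces to (i) through deterministic inequalities that hold for each outcome
separately. The operator norm of `R̂ - R` is at most its Hilbert–Schmidt norm. Weyl's inequality
(`abs_eigenvalueSeq_sub_le`) bounds every eigenvalue difference by that operator norm, uniformly in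
`j`. For a simple positive eigenvalue, `exists_norm_sub_le_mul_norm_sub` bounds the eigenvector
error by a constant times the operator norm, and the constant depends only on the limit operator. No
measurability of the estimated eigenvectors is needed, since they are dominated pointwise.

For (i), the kernel of `R` is quadratic in the `C_k`, which are bounded by 1, so it suffices that
`Ĉ_k - C_k` tends to 0 in `L²(μ ⊗ μ)` for each lag. Up to an error `3p/n`, `Ĉ_k(x, y)` is the
average of `F̂_t(x) F̂_{t+k}(y)` minus the product of the empirical means.

Replacing `F̂` by `F` in these averages is a law of large numbers. By cyclic independence, the
errors over disjoint sets of cycles are uncorrelated (`integral_prod_sub_mul_prod_sub_eq_zero`), so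
only `O(n)` of the `n²` covariances survive and the mean square is at most `3/n`. The latent product
averages converge by assumption. The latent mean converges because closeness in the Lévy–Prokhorov
metric controls distribution functions except near places where the barycenter has much mass, and
its atoms, being countable, are `μ`-null. -/

theorem isCompactOperator_innerSL_smulRight (u v : H) :
    IsCompactOperator ((innerSL ℝ u).smulRight v : H →L[ℝ] H) :=
  ((isCompactOperator_id (E := ℝ)).comp_clm (innerSL ℝ u)).clm_comp
    ((ContinuousLinearMap.id ℝ ℝ).smulRight v)

/-- Decompose `x` along the mutually orthogonal eigenspaces; the weights are the squared norms of
the components. Since they do not depend on `s`, the sign of `a - s` yields both form bounds below.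
-/
theorem exists_form_eq_sum_of_mem_iSup_eigenspace {T : H →L[ℝ] H}
    (hT : (T : H →ₗ[ℝ] H).IsSymmetric) {S : Set ℝ} {x : H}
    (hx : x ∈ ⨆ a ∈ S, Module.End.eigenspace (T : H →ₗ[ℝ] H) a) :
    ∃ (t : Finset S) (w : S → ℝ), (∀ a, 0 ≤ w a) ∧
      ∀ s : ℝ, inner ℝ (T x) x - s * ‖x‖ ^ 2 = ∑ a ∈ t, ((a : ℝ) - s) * w a := by
  rw [iSup_subtype', Submodule.mem_iSup_iff_exists_finsupp] at hx
  obtain ⟨f, hf, rfl⟩ := hx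
  have horth : OrthogonalFamily ℝ
      (fun a : S => Module.End.eigenspace (T : H →ₗ[ℝ] H) (a : ℝ))
      fun a => (Module.End.eigenspace (T : H →ₗ[ℝ] H) (a : ℝ)).subtypeₗᵢ :=
    hT.orthogonalFamily_eigenspaces.comp Subtype.val_injective
  refine ⟨f.support, fun a => ‖f a‖ ^ 2, fun a => by positivity, fun s => ?_⟩
  have hTf : ∀ a : S, T (f a) = (a : ℝ) • f a := fun a =>
    Module.End.mem_eigenspace_iff.1 (hf a)
  have h1 := horth.inner_sum (fun a => ⟨(a : ℝ) • f a, Submodule.smul_mem _ _ (hf a)⟩)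
    (fun a => ⟨f a, hf a⟩) f.support
  have h2 := horth.inner_sum (fun a => ⟨f a, hf a⟩) (fun a => ⟨f a, hf a⟩) f.support
  simp only [Submodule.coe_subtypeₗᵢ, Submodule.subtype_apply, Submodule.coe_inner,
    real_inner_self_eq_norm_sq, real_inner_smul_left] at h1 h2
  rw [Finsupp.sum, map_sum]
  simp only [hTf]
  rw [h1, h2, Finset.mul_sum, ← Finset.sum_sub_distrib]
  exact Finset.sum_congr rfl fun a _ => by ring

theorem le_form_of_mem_iSup_eigenspace {T : H →L[ℝ] H} (hT : (T : H →ₗ[ℝ] H).IsSymmetric)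
    {S : Set ℝ} {s : ℝ} (hs : ∀ a ∈ S, s ≤ a) {x : H}
    (hx : x ∈ ⨆ a ∈ S, Module.End.eigenspace (T : H →ₗ[ℝ] H) a) :
    s * ‖x‖ ^ 2 ≤ inner ℝ (T x) x := by
  obtain ⟨t, w, hw, h⟩ := exists_form_eq_sum_of_mem_iSup_eigenspace hT hx
  have := Finset.sum_nonneg fun (a : S) (_ : a ∈ t) =>
    mul_nonneg (sub_nonneg.2 (hs a a.2)) (hw a)
  linarith [h s]

theorem form_le_of_mem_iSup_eigenspace {T : H →L[ℝ] H} (hT : (T : H →ₗ[ℝ] H).IsSymmetric)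
    {S : Set ℝ} {s : ℝ} (hs : ∀ a ∈ S, a ≤ s) {x : H}
    (hx : x ∈ ⨆ a ∈ S, Module.End.eigenspace (T : H →ₗ[ℝ] H) a) :
    inner ℝ (T x) x ≤ s * ‖x‖ ^ 2 := by
  obtain ⟨t, w, hw, h⟩ := exists_form_eq_sum_of_mem_iSup_eigenspace hT hx
  have := Finset.sum_nonpos fun (a : S) (_ : a ∈ t) =>
    mul_nonpos_of_nonpos_of_nonneg (sub_nonpos.2 (hs a a.2)) (hw a)
  linarith [h s]

theorem eigenvalueSeq_nonneg (T : H →L[ℝ] H) (j : ℕ) : 0 ≤ eigenvalueSeq T j :=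
  Real.sSup_nonneg fun _ hs => hs.1.le

/-- The set whose supremum defines the `j`-th eigenvalue. -/
def eigenvalueLevels (T : H →L[ℝ] H) (j : ℕ) : Set ℝ :=
  {s : ℝ | 0 < s ∧ ((j + 1 : ℕ) : Cardinal) ≤
    Module.rank ℝ ↥(⨆ a ∈ Set.Ici s, Module.End.eigenspace (T : H →ₗ[ℝ] H) a)}

/-- The easy half of the min-max principle. The span of the eigenspaces may have infinite rank
without compactness, so `j + 1` independent vectors are selected from it. -/
theorem exists_submodule_of_mem_eigenvalueLevels {T : H →L[ℝ] H}
    (hT : (T : H →ₗ[ℝ] H).IsSymmetric) {j : ℕ} {s : ℝ} (hs : s ∈ eigenvalueLevels T j) :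
    ∃ V : Submodule ℝ H, Module.finrank ℝ V = j + 1 ∧
      ∀ x ∈ V, s * ‖x‖ ^ 2 ≤ inner ℝ (T x) x := by
  let W : Submodule ℝ H := ⨆ a ∈ Set.Ici s, Module.End.eigenspace (T : H →ₗ[ℝ] H) a
  obtain ⟨t, ht, hli⟩ := le_rank_iff_exists_linearIndependent_finset.1
    (show _ ≤ Module.rank ℝ W from hs.2)
  refine ⟨(Submodule.span ℝ (t : Set W)).map W.subtype, ?_, ?_⟩
  · rw [Submodule.finrank_map_subtype_eq, ← ht]
    exact finrank_span_finset_eq_card hli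
  · rintro _ ⟨x, -, rfl⟩
    exact le_form_of_mem_iSup_eigenspace hT (fun a ha => ha) x.2

theorem le_norm_of_mem_eigenvalueLevels {T : H →L[ℝ] H}
    (hT : (T : H →ₗ[ℝ] H).IsSymmetric) {j : ℕ} {s : ℝ} (hs : s ∈ eigenvalueLevels T j) :
    s ≤ ‖T‖ := by
  obtain ⟨V, hV, h⟩ := exists_submodule_of_mem_eigenvalueLevels hT hs
  have hne : V ≠ ⊥ := by
    rintro rfl
    simp at hV
  obtain ⟨x, hx, hx0⟩ := (Submodule.ne_bot_iff _).1 hne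
  have h1 := h x hx
  have h2 : inner ℝ (T x) x ≤ ‖T‖ * ‖x‖ ^ 2 := by
    refine (real_inner_le_norm _ _).trans ?_
    rw [pow_two, ← mul_assoc]
    exact mul_le_mul_of_nonneg_right (T.le_opNorm x) (norm_nonneg x)
  exact le_of_mul_le_mul_right (h1.trans h2) (by positivity)

theorem bddAbove_eigenvalueLevels {T : H →L[ℝ] H}
    (hT : (T : H →ₗ[ℝ] H).IsSymmetric) (j : ℕ) : BddAbove (eigenvalueLevels T j) :=
  ⟨‖T‖, fun _ hs => le_norm_of_mem_eigenvalueLevels hT hs⟩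

theorem eigenvalueSeq_antitone {T : H →L[ℝ] H} (hT : (T : H →ₗ[ℝ] H).IsSymmetric) :
    Antitone (eigenvalueSeq T) := by
  intro i j hij
  rcases (eigenvalueLevels T j).eq_empty_or_nonempty with h | h
  · have : eigenvalueSeq T j = 0 := by
      rw [eigenvalueSeq]; rw [eigenvalueLevels] at h; rw [h, Real.sSup_empty]
    exact this ▸ eigenvalueSeq_nonneg T i
  · exact csSup_le_csSup (bddAbove_eigenvalueLevels hT i) h fun s hs =>
      ⟨hs.1, (Nat.cast_le.2 (by omega)).trans hs.2⟩

/-- If the positive eigenvalues are simple, an eigenvector for the `j`-th eigenvalue orthogonal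
to the `j`-th member of an eigensystem vanishes. -/
theorem eq_zero_of_apply_eq_of_inner_eq_zero {T : H →L[ℝ] H}
    (hT : (T : H →ₗ[ℝ] H).IsSymmetric) {ψ : ℕ → H} (hψ : IsEigenSystem T ψ) {j : ℕ}
    (hj : 0 < eigenvalueSeq T j) (hsimple : ∀ i, j ≠ i → eigenvalueSeq T j ≠ eigenvalueSeq T i)
    {φ : H} (hφ : T φ = eigenvalueSeq T j • φ) (horth : inner ℝ (ψ j) φ = 0) : φ = 0 := by
  by_contra hne
  -- For `i ≠ j` the eigenvalues differ, and symmetry forces orthogonality.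
  have hall : ∀ i, inner ℝ (ψ i) φ = 0 := by
    intro i
    by_cases hij : j = i
    · exact hij ▸ horth
    have h1 : inner ℝ (T (ψ i)) φ = inner ℝ (ψ i) (T φ) := hT (ψ i) φ
    rw [hψ.2 i, hφ, real_inner_smul_left, real_inner_smul_right] at h1
    exact (mul_eq_mul_right_iff.1 h1).resolve_left (hsimple i hij).symm
  -- The vectors `ψ 0, …, ψ j` and `φ` are `j + 2` orthogonal nonzero eigenvectors with eigenvalues
  -- at least `θ_j`. Hence `θ_{j+1} ≥ θ_j`, which contradicts simplicity.
  have hmem : eigenvalueSeq T j ∈ eigenvalueLevels T (j + 1) := by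
    refine ⟨hj, ?_⟩
    set W := ⨆ a ∈ Set.Ici (eigenvalueSeq T j), Module.End.eigenspace (T : H →ₗ[ℝ] H) a with hW
    have hsub : ∀ (a : ℝ) (v : H), eigenvalueSeq T j ≤ a → T v = a • v → v ∈ W :=
      fun a v ha hv => (le_iSup₂_of_le (f := fun a (_ : a ∈ Set.Ici (eigenvalueSeq T j)) =>
        Module.End.eigenspace (T : H →ₗ[ℝ] H) a) a ha le_rfl)
          (Module.End.mem_eigenspace_iff.2 hv)
    let v : Option (Fin (j + 1)) → W := fun o => o.elim ⟨φ, hsub _ _ le_rfl hφ⟩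
      fun i => ⟨ψ i, hsub _ _ (eigenvalueSeq_antitone hT (Nat.lt_succ_iff.1 i.2)) (hψ.2 i)⟩
    have hli : LinearIndependent ℝ v := by
      refine linearIndependent_of_ne_zero_of_inner_eq_zero ?_ ?_
      · rintro (_ | i) h
        · exact hne (congrArg Subtype.val h)
        · exact hψ.1.ne_zero i (congrArg Subtype.val h)
      · rintro (_ | i) (_ | k) h
        · exact absurd rfl h
        · exact (real_inner_comm _ _).trans (hall k)
        · exact hall i
        · exact hψ.1.2 fun hik => h (congrArg some (Fin.ext hik))
    simpa using hli.cardinal_lift_le_rank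
  have h1 : eigenvalueSeq T j ≤ eigenvalueSeq T (j + 1) :=
    le_csSup (bddAbove_eigenvalueLevels hT (j + 1)) hmem
  exact hsimple (j + 1) (by omega) (le_antisymm h1 (eigenvalueSeq_antitone hT (by omega)))

variable [CompleteSpace H]

/-- By the spectral theorem the eigenspaces span a dense subspace, so a vector orthogonal to those
at levels `≥ s` is a limit of sums of eigenvectors at levels `< s`. There the form bound holds, and
it is a closed condition. -/
theorem form_le_of_mem_orthogonal_iSup_eigenspace {T : H →L[ℝ] H} (hc : IsCompactOperator T)
    (hT : (T : H →ₗ[ℝ] H).IsSymmetric) {s : ℝ} {x : H}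
    (hx : x ∈ (⨆ a ∈ Set.Ici s, Module.End.eigenspace (T : H →ₗ[ℝ] H) a)ᗮ) :
    inner ℝ (T x) x ≤ s * ‖x‖ ^ 2 := by
  set W := ⨆ a ∈ Set.Ici s, Module.End.eigenspace (T : H →ₗ[ℝ] H) a with hW
  set U := ⨆ a ∈ Set.Iio s, Module.End.eigenspace (T : H →ₗ[ℝ] H) a with hU
  have hUW : U ⟂ W := by
    simp only [hU, hW, Submodule.isOrtho_iSup_left, Submodule.isOrtho_iSup_right]
    intro a ha b hb
    exact hT.orthogonalFamily_eigenspaces.isOrtho (lt_of_lt_of_le hb ha).ne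
  have hbot : (U ⊔ W)ᗮ = ⊥ := by
    rw [eq_bot_iff, ← ContinuousLinearMap.orthogonalComplement_iSup_eigenspaces_eq_bot hc hT]
    refine Submodule.orthogonal_le (iSup_le fun a => ?_)
    rcases lt_or_ge a s with h | h
    · exact (le_iSup₂_of_le (f := fun a (_ : a ∈ Set.Iio s) =>
        Module.End.eigenspace (T : H →ₗ[ℝ] H) a) a h le_rfl).trans le_sup_left
    · exact (le_iSup₂_of_le (f := fun a (_ : a ∈ Set.Ici s) =>
        Module.End.eigenspace (T : H →ₗ[ℝ] H) a) a h le_rfl).trans le_sup_right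
  have hcl : U.topologicalClosure ≤ Wᗮ :=
    U.topologicalClosure_minimal hUW (Submodule.isClosed_orthogonal W)
  have hmem : x ∈ U.topologicalClosure := by
    obtain ⟨u, hu, v, hv, rfl⟩ := U.topologicalClosure.exists_add_mem_mem_orthogonal x
    have hvW : v ∈ Wᗮ := by simpa using Submodule.sub_mem _ hx (hcl hu)
    have hvU : v ∈ Uᗮ := Submodule.orthogonal_le U.le_topologicalClosure hv
    have : v ∈ (U ⊔ W)ᗮ := by
      rw [← Submodule.inf_orthogonal]
      exact ⟨hvU, hvW⟩
    rw [hbot, Submodule.mem_bot] at this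
    simpa [this] using hu
  have hclosed : IsClosed {y : H | inner ℝ (T y) y ≤ s * ‖y‖ ^ 2} :=
    isClosed_le (by fun_prop) (by fun_prop)
  exact closure_minimal (s := (U : Set H))
    (fun y hy => form_le_of_mem_iSup_eigenspace hT (fun a ha => le_of_lt ha) hy) hclosed hmem

/-- The other half of the min-max principle, by counting dimensions. If the eigenspaces at levels `≥
r` had total dimension at most `j`, the projection of `V` onto their span would have a kernel, and a
nonzero `x` there would satisfy `s‖x‖² ≤ ⟨Tx, x⟩ ≤ r‖x‖²`. -/
theorem mem_eigenvalueLevels_of_submodule {T : H →L[ℝ] H} (hc : IsCompactOperator T)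
    (hT : (T : H →ₗ[ℝ] H).IsSymmetric) {j : ℕ} {r s : ℝ} (hr : 0 < r) (hrs : r < s)
    {V : Submodule ℝ H} (hV : Module.finrank ℝ V = j + 1)
    (h : ∀ x ∈ V, s * ‖x‖ ^ 2 ≤ inner ℝ (T x) x) : r ∈ eigenvalueLevels T j := by
  refine ⟨hr, ?_⟩
  by_contra! hlt
  set W := ⨆ a ∈ Set.Ici r, Module.End.eigenspace (T : H →ₗ[ℝ] H) a with hW
  have hfin : FiniteDimensional ℝ W :=
    Module.rank_lt_aleph0_iff.1 (hlt.trans (Cardinal.natCast_lt_aleph0))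
  have : FiniteDimensional ℝ V := Module.finite_of_finrank_pos (by omega)
  rw [← Module.finrank_eq_rank, Nat.cast_lt] at hlt
  obtain ⟨x, hx, hx0⟩ := (Submodule.ne_bot_iff _).1
    (LinearMap.ker_ne_bot_of_finrank_lt
      (f := (W.orthogonalProjectionOnto : H →ₗ[ℝ] W) ∘ₗ V.subtype) (by omega))
  have hxW : (x : H) ∈ Wᗮ := by
    rw [← Submodule.orthogonalProjectionOnto_eq_zero_iff]
    simpa using hx
  have h1 := form_le_of_mem_orthogonal_iSup_eigenspace hc hT hxW
  have h2 := h x x.2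
  have h3 : 0 < ‖(x : H)‖ ^ 2 := by
    have : (x : H) ≠ 0 := by simpa using hx0
    positivity
  nlinarith

/-- **Weyl's inequality** for the positive eigenvalues, one-sided. -/
theorem eigenvalueSeq_le_add_norm_sub {A B : H →L[ℝ] H} (hA : (A : H →ₗ[ℝ] H).IsSymmetric)
    (hcB : IsCompactOperator B) (hB : (B : H →ₗ[ℝ] H).IsSymmetric) (j : ℕ) :
    eigenvalueSeq A j ≤ eigenvalueSeq B j + ‖A - B‖ := by
  refine Real.sSup_le (fun s hs => ?_)
    (add_nonneg (eigenvalueSeq_nonneg B j) (norm_nonneg _))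
  obtain ⟨V, hV, h⟩ := exists_submodule_of_mem_eigenvalueLevels hA hs
  -- The slack `ε` pays for the strict inequality between the form bound and the level obtained from
  -- it.
  refine le_of_forall_pos_le_add fun ε hε => ?_
  rcases le_or_gt (s - ‖A - B‖ - ε) 0 with hle | hlt
  · linarith [eigenvalueSeq_nonneg B j]
  have hmem : s - ‖A - B‖ - ε ∈ eigenvalueLevels B j := by
    refine mem_eigenvalueLevels_of_submodule hcB hB hlt (s := s - ‖A - B‖) (by linarith) hV
      fun x hx => ?_
    have h1 : inner ℝ ((A - B) x) x ≤ ‖A - B‖ * ‖x‖ ^ 2 := by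
      refine (real_inner_le_norm _ _).trans ?_
      rw [pow_two, ← mul_assoc]
      exact mul_le_mul_of_nonneg_right ((A - B).le_opNorm x) (norm_nonneg x)
    rw [sub_apply, inner_sub_left] at h1
    linarith [h x hx]
  have := le_csSup (bddAbove_eigenvalueLevels hB j) hmem
  change s - ‖A - B‖ - ε ≤ eigenvalueSeq B j at this
  linarith

theorem abs_eigenvalueSeq_sub_le {A B : H →L[ℝ] H} (hcA : IsCompactOperator A)
    (hA : (A : H →ₗ[ℝ] H).IsSymmetric) (hcB : IsCompactOperator B)
    (hB : (B : H →ₗ[ℝ] H).IsSymmetric) (j : ℕ) :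
    |eigenvalueSeq A j - eigenvalueSeq B j| ≤ ‖A - B‖ := by
  have h1 := eigenvalueSeq_le_add_norm_sub hA hcB hB j
  have h2 := eigenvalueSeq_le_add_norm_sub hB hcA hA j
  rw [norm_sub_rev] at h2
  rw [abs_le]
  constructor <;> linarith

/-- Perturbation bound for the eigenvector of a simple positive eigenvalue. -/
theorem exists_norm_sub_le_mul_norm_sub {T : H →L[ℝ] H} (hc : IsCompactOperator T)
    (hT : (T : H →ₗ[ℝ] H).IsSymmetric) {ψ : ℕ → H} (hψ : IsEigenSystem T ψ) {j : ℕ}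
    (hj : 0 < eigenvalueSeq T j)
    (hsimple : ∀ i, j ≠ i → eigenvalueSeq T j ≠ eigenvalueSeq T i) :
    ∃ C : ℝ≥0, ∀ A : H →L[ℝ] H, IsCompactOperator A → (A : H →ₗ[ℝ] H).IsSymmetric →
      ∀ φ : ℕ → H, IsEigenSystem A φ → 0 ≤ inner ℝ (φ j) (ψ j) →
        ‖φ j - ψ j‖ ≤ C * ‖A - T‖ := by
  set θ := eigenvalueSeq T j with hθ
  have hψj : ‖ψ j‖ = 1 := hψ.1.1 j
  -- Deflation: `Q` projects onto `ψ j`, and subtracting `θ • Q` moves the simple eigenvalue `θ` to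
  -- 0 while leaving `T` unchanged on the complement of `ψ j`.
  let Q : H →L[ℝ] H := (innerSL ℝ (ψ j)).smulRight (ψ j)
  have hQ : ∀ x, Q x = inner ℝ (ψ j) x • ψ j := fun x => rfl
  have hQc : IsCompactOperator (θ • Q) := by
    refine IsCompactOperator.smul ?_ θ
    exact isCompactOperator_innerSL_smulRight (ψ j) (ψ j)
  have hno : ¬ Module.End.HasEigenvalue ((T - θ • Q : H →L[ℝ] H) : Module.End ℝ H) θ := by
    intro h
    obtain ⟨φ, hφ⟩ := h.exists_hasEigenvector
    have h1 : T φ - θ • inner ℝ (ψ j) φ • ψ j = θ • φ := hφ.apply_eq_smul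
    have h2 : inner ℝ (ψ j) φ = 0 := by
      have h3 := congrArg (fun z => inner ℝ (ψ j) z) h1
      have h4 : inner ℝ (T (ψ j)) φ = inner ℝ (ψ j) (T φ) := hT (ψ j) φ
      simp only [inner_sub_right, ← h4, hψ.2 j, real_inner_smul_left, real_inner_smul_right,
        real_inner_self_eq_norm_sq, hψj] at h3
      have h5 : θ * inner ℝ (ψ j) φ = 0 := by linarith
      exact (mul_eq_zero.1 h5).resolve_left hj.ne'
    refine hφ.2 (eq_zero_of_apply_eq_of_inner_eq_zero hT hψ hj hsimple ?_ h2)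
    simpa [h2] using h1
  -- Fredholm alternative: as `θ ≠ 0` is not an eigenvalue of the compact operator `T - θ • Q`, the
  -- operator `T - θ • Q - θ` is bounded below. This plays the role of the spectral gap.
  obtain ⟨K, hK⟩ := (hc.sub hQc).antilipschitz_of_not_hasEigenvalue hj.ne' hno
  refine ⟨4 * K, fun A hcA hA φ hφ hpos => ?_⟩
  have hφj : ‖φ j‖ = 1 := hφ.1.1 j
  set c := inner ℝ (ψ j) (φ j) with hcdef
  have hc0 : 0 ≤ c := by rwa [hcdef, real_inner_comm]
  set w := φ j - c • ψ j with hw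
  have hwψ : inner ℝ (ψ j) w = 0 := by
    rw [hw, inner_sub_right, real_inner_smul_right, real_inner_self_eq_norm_sq, hψj, ← hcdef]
    ring
  have hww : ‖w‖ ^ 2 = 1 - c ^ 2 := by
    rw [hw, @norm_sub_sq_real, norm_smul, real_inner_smul_right, real_inner_comm, ← hcdef, hψj,
      hφj, Real.norm_eq_abs, mul_one, sq_abs]
    ring
  -- `T - θ` kills `ψ j`, so it takes the same value at `w` as at `φ j`. Each summand has norm at
  -- most `‖A - T‖`, the second by Weyl.
  have hT1 : T w - θ • w = (T - A) (φ j) + (eigenvalueSeq A j - θ) • φ j := by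
    rw [hw, map_sub, map_smul, hψ.2 j, sub_apply, hφ.2 j, smul_sub, sub_smul,
      smul_comm c]
    abel
  have hT2 : ‖T w - θ • w‖ ≤ 2 * ‖A - T‖ := by
    rw [hT1]
    refine (norm_add_le _ _).trans ?_
    have h1 := (T - A).le_opNorm (φ j)
    have h2 := abs_eigenvalueSeq_sub_le hcA hA hc hT j
    rw [norm_smul, hφj, Real.norm_eq_abs]
    rw [hφj, norm_sub_rev] at h1
    linarith
  have hT3 : ‖w‖ ≤ K * ‖T w - θ • w‖ := by
    have := hK.le_mul_dist w 0
    simpa [hQ, hwψ] using this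
  have hwle : ‖w‖ ≤ K * (2 * ‖A - T‖) :=
    hT3.trans (mul_le_mul_of_nonneg_left hT2 K.2)
  -- The left side is `2(1 - c)` and the right side is `4(1 - c)(1 + c)`; the sign choice `c ≥ 0` is
  -- what makes this work. With `‖w‖ ≤ 2K‖A - T‖` it gives the constant `4K`.
  have hsq : ‖φ j - ψ j‖ ^ 2 ≤ (2 * ‖w‖) ^ 2 := by
    rw [@norm_sub_sq_real, real_inner_comm, ← hcdef, hψj, hφj]
    have : c ≤ 1 := by
      have := real_inner_le_norm (ψ j) (φ j)
      rwa [hψj, hφj, mul_one] at this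
    nlinarith
  have h5 : ‖φ j - ψ j‖ ≤ 2 * ‖w‖ := by
    exact le_of_sq_le_sq hsq (by positivity)
  push_cast
  linarith

end SpectralPerturbation

/-! ### Compactness of Hilbert–Schmidt operators -/

section HilbertSchmidt

variable {H : Type*} [NormedAddCommGroup H] [InnerProductSpace ℝ H] [CompleteSpace H]

/-- A Hilbert–Schmidt operator is compact. -/
theorem isCompactOperator_of_sum_norm_sq_le {ι : Type*} (b : HilbertBasis ι ℝ H)
    {T : H →L[ℝ] H} {C : ℝ} (hC : ∀ s : Finset ι, ∑ i ∈ s, ‖T (b i)‖ ^ 2 ≤ C) :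
    IsCompactOperator T := by
  classical
  -- Finite-rank truncations of `T`. By Cauchy–Schwarz and Bessel, `‖T - F s‖²` is at most the tail
  -- of `∑ ‖T (b i)‖²` outside `s`.
  let F : Finset ι → H →L[ℝ] H := fun s =>
    ∑ i ∈ s, (innerSL ℝ (b i)).smulRight (T (b i))
  have hF : ∀ s x, F s x = ∑ i ∈ s, inner ℝ (b i) x • T (b i) := fun s x => by
    simp [F]
  have hFc : ∀ s, IsCompactOperator (F s) := fun s =>
    Submodule.sum_mem (compactOperator (RingHom.id ℝ) H H)
      fun i _ => isCompactOperator_innerSL_smulRight (b i) (T (b i))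
  have hsum : Summable fun i => ‖T (b i)‖ ^ 2 :=
    summable_of_sum_le (fun i => by positivity) hC
  refine isCompactOperator_of_tendsto (F := F) (l := atTop) ?_ (Eventually.of_forall hFc)
  rw [Metric.tendsto_atTop]
  intro ε hε
  obtain ⟨s₀, hs₀⟩ := summable_iff_vanishing_norm.1 hsum ((ε / 2) ^ 2) (by positivity)
  refine ⟨s₀, fun s hs => ?_⟩
  rw [dist_eq_norm, norm_sub_rev]
  refine (ContinuousLinearMap.opNorm_le_bound _ (half_pos hε).le fun x => ?_).trans_lt
    (half_lt_self hε)
  have hlim : Tendsto (fun t => ‖F t x - F s x‖) atTop (𝓝 ‖(T - F s) x‖) := by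
    have h1 := ((b.hasSum_repr x).mapL T)
    have h2 : Tendsto (fun t => F t x) atTop (𝓝 (T x)) := by
      refine Tendsto.congr (fun t => ?_) h1
      rw [hF]
      simp [b.repr_apply_apply]
    exact (h2.sub_const _).norm
  refine le_of_tendsto hlim ((eventually_ge_atTop s).mono fun t ht => ?_)
  have h3 : F t x - F s x = ∑ i ∈ t \ s, inner ℝ (b i) x • T (b i) := by
    rw [hF, hF, sub_eq_iff_eq_add, Finset.sum_sdiff ht]
  rw [h3]
  have h4 : ∑ i ∈ t \ s, ‖T (b i)‖ ^ 2 ≤ (ε / 2) ^ 2 := by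
    have := hs₀ (t \ s) (Finset.disjoint_of_subset_right hs Finset.sdiff_disjoint)
    exact (le_abs_self _).trans this.le
  have h5 : ∑ i ∈ t \ s, ‖inner ℝ (b i) x‖ ^ 2 ≤ ‖x‖ ^ 2 :=
    b.orthonormal.sum_inner_products_le x
  refine le_of_sq_le_sq ?_ (by positivity)
  calc ‖∑ i ∈ t \ s, inner ℝ (b i) x • T (b i)‖ ^ 2
      ≤ (∑ i ∈ t \ s, ‖inner ℝ (b i) x‖ * ‖T (b i)‖) ^ 2 := by
        gcongr
        exact (norm_sum_le _ _).trans_eq (Finset.sum_congr rfl fun i _ => norm_smul _ _)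
    _ ≤ (∑ i ∈ t \ s, ‖inner ℝ (b i) x‖ ^ 2) * ∑ i ∈ t \ s, ‖T (b i)‖ ^ 2 :=
        Finset.sum_mul_sq_le_sq_mul_sq _ _ _
    _ ≤ ‖x‖ ^ 2 * (ε / 2) ^ 2 := by gcongr
    _ = (ε / 2 * ‖x‖) ^ 2 := by ring

end HilbertSchmidt

/-! ### Integral operators: norm, symmetry, compactness -/

section IntegralOperator

theorem lagKernel_comm (μ : Measure ℝ) (p : ℕ) (C : ℕ → ℝ → ℝ → ℝ) (x y : ℝ) :
    lagKernel μ p C x y = lagKernel μ p C y x := by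
  simp only [lagKernel, mul_comm]

variable {μ : Measure ℝ} [IsFiniteMeasure μ] {K L : ℝ → ℝ → ℝ}

theorem integralOp_apply_ae (hK : MemLp (Function.uncurry K) 2 (μ.prod μ)) (f : Lp ℝ 2 μ) :
    integralOp hK f =ᵐ[μ] fun x => ∫ y, K x y * f y ∂μ :=
  MemLp.coeFn_toLp (memLp_integral_mul hK (Lp.memLp f))

theorem norm_integralOp_sub_le (hK : MemLp (Function.uncurry K) 2 (μ.prod μ))
    (hL : MemLp (Function.uncurry L) 2 (μ.prod μ)) :
    ‖integralOp hK - integralOp hL‖ ≤ (hsNorm μ fun x y => K x y - L x y).toReal := by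
  have hKL : MemLp (Function.uncurry fun x y => K x y - L x y) 2 (μ.prod μ) := hK.sub hL
  have h : integralOp hK - integralOp hL = integralOp hKL := by
    ext1 f
    rw [sub_apply]
    refine Lp.ext ?_
    filter_upwards [Lp.coeFn_sub (integralOp hK f) (integralOp hL f), integralOp_apply_ae hK f,
      integralOp_apply_ae hL f, integralOp_apply_ae hKL f, ae_memLp_section hK,
      ae_memLp_section hL] with x h1 h2 h3 h4 h5 h6
    rw [h1, Pi.sub_apply, h2, h3, h4]
    refine Eq.trans (integral_sub (h5.integrable_mul (Lp.memLp f))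
      (h6.integrable_mul (Lp.memLp f))).symm ?_
    exact integral_congr_ae (Eventually.of_forall fun y => (sub_mul _ _ _).symm)
  rw [h]
  exact LinearMap.mkContinuous_norm_le _ ENNReal.toReal_nonneg _

theorem isSymmetric_integralOp (hK : MemLp (Function.uncurry K) 2 (μ.prod μ))
    (hsymm : ∀ x y, K x y = K y x) :
    (integralOp hK : Lp ℝ 2 μ →ₗ[ℝ] Lp ℝ 2 μ).IsSymmetric := by
  have key : ∀ f g : Lp ℝ 2 μ, inner ℝ (integralOp hK f) g = ∫ x, ∫ y, K x y * f y * g x ∂μ ∂μ := by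
    intro f g
    rw [L2.inner_def]
    refine integral_congr_ae ?_
    filter_upwards [integralOp_apply_ae hK f] with x hx
    rw [hx, integral_mul_const]
    simp [mul_comm]
  intro f g
  change inner ℝ (integralOp hK f) g = inner ℝ f (integralOp hK g)
  rw [real_inner_comm (integralOp hK g) f, key, key, integral_integral_swap]
  · refine integral_congr_ae (Eventually.of_forall fun x =>
      integral_congr_ae (Eventually.of_forall fun y => ?_))
    simp only [hsymm x y]
    ring
  -- Fubini applies because the integrand is a product of two elements of `L²(μ ⊗ μ)`.
  · have hfg : MemLp (fun z : ℝ × ℝ => f z.2 * g z.1) 2 (μ.prod μ) := by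
      refine (memLp_two_iff_integrable_sq
        ((Lp.memLp f).1.comp_snd.mul (Lp.memLp g).1.comp_fst)).2 ?_
      refine ((Lp.memLp g).integrable_sq.mul_prod (Lp.memLp f).integrable_sq).congr
        (Eventually.of_forall fun z => ?_)
      simp only [Pi.mul_apply]
      ring
    refine (hK.integrable_mul hfg).congr (Eventually.of_forall fun z => ?_)
    simp [Function.uncurry, mul_assoc]

/-- For almost every `x` the values `(T b_i)(x)` are the Fourier coefficients of the section `K x`.
Bessel's inequality, integrated over `x`, bounds `∑ ‖T b_i‖²` by the squared `L²` norm of the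
kernel. -/
theorem isCompactOperator_integralOp (hK : MemLp (Function.uncurry K) 2 (μ.prod μ)) :
    IsCompactOperator (integralOp hK) := by
  obtain ⟨w, b, -⟩ := exists_hilbertBasis ℝ (Lp ℝ 2 μ)
  have hK2 : Integrable (fun z : ℝ × ℝ => Function.uncurry K z ^ 2) (μ.prod μ) :=
    (memLp_two_iff_integrable_sq hK.1).1 hK
  refine isCompactOperator_of_sum_norm_sq_le b (C := ∫ x, ∫ y, K x y ^ 2 ∂μ ∂μ) fun s => ?_
  have hnorm : ∀ f : Lp ℝ 2 μ, ‖integralOp hK f‖ ^ 2 = ∫ x, (integralOp hK f x) ^ 2 ∂μ := by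
    intro f
    rw [← real_inner_self_eq_norm_sq, L2.inner_def]
    simp [pow_two]
  simp only [hnorm]
  rw [← integral_finsetSum _ fun i _ => (Lp.memLp (integralOp hK (b i))).integrable_sq]
  refine integral_mono_ae (integrable_finsetSum _ fun i _ =>
    (Lp.memLp (integralOp hK (b i))).integrable_sq) hK2.integral_prod_left ?_
  have hall : ∀ᵐ x ∂μ, ∀ i ∈ s, integralOp hK (b i) x = ∫ y, K x y * b i y ∂μ :=
    (ae_ball_iff s.countable_toSet).2 fun i _ => integralOp_apply_ae hK (b i)
  filter_upwards [hall, ae_memLp_section hK] with x hx hKx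
  have h1 := b.orthonormal.sum_inner_products_le (s := s) (hKx.toLp (K x))
  have h2 : ∀ i, inner ℝ (b i) (hKx.toLp (K x)) = ∫ y, K x y * b i y ∂μ := by
    intro i
    rw [L2.inner_def]
    refine integral_congr_ae ?_
    filter_upwards [hKx.coeFn_toLp] with y hy
    simp [hy]
  have h3 : ‖hKx.toLp (K x)‖ ^ 2 = ∫ y, K x y ^ 2 ∂μ := by
    rw [← real_inner_self_eq_norm_sq, L2.inner_def]
    refine integral_congr_ae ?_
    filter_upwards [hKx.coeFn_toLp] with y hy
    simp [hy, pow_two]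
  rw [h3] at h1
  refine le_trans (le_of_eq (Finset.sum_congr rfl fun i hi => ?_)) h1
  rw [hx i hi, h2, Real.norm_eq_abs, sq_abs]

end IntegralOperator

/-! ### Calculus of convergence in probability -/

section LittleOP

variable {Ω : Type*} [MeasurableSpace Ω] {P : Measure Ω} {Y Z : ℕ → Ω → ℝ≥0∞}

theorem IsLittleOP.mono (hZ : IsLittleOP P Z) (h : ∀ᶠ n in atTop, ∀ ω, Y n ω ≤ Z n ω) :
    IsLittleOP P Y := fun ε hε =>
  tendsto_of_tendsto_of_tendsto_of_le_of_le' tendsto_const_nhds (hZ ε hε)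
    (Eventually.of_forall fun _ => zero_le)
    (h.mono fun n hn => measure_mono fun ω (hω : ε ≤ Y n ω) => hω.trans (hn ω))

theorem IsLittleOP.add (hY : IsLittleOP P Y) (hZ : IsLittleOP P Z) :
    IsLittleOP P fun n ω => Y n ω + Z n ω := by
  intro ε hε
  have h := (hY (ε / 2) (ENNReal.half_pos hε.ne')).add (hZ (ε / 2) (ENNReal.half_pos hε.ne'))
  rw [add_zero] at h
  refine tendsto_of_tendsto_of_tendsto_of_le_of_le tendsto_const_nhds h
    (fun _ => zero_le) fun n => (measure_mono fun ω hω => ?_).trans (measure_union_le _ _)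
  by_contra hcon
  simp only [Set.mem_union, Set.mem_ofPred_eq, not_or, not_le] at hcon
  have := ENNReal.add_lt_add hcon.1 hcon.2
  rw [ENNReal.add_halves] at this
  exact absurd hω (not_le.2 this)

theorem isLittleOP_of_tendsto {c : ℕ → ℝ≥0∞} (hc : Tendsto c atTop (𝓝 0)) :
    IsLittleOP P fun n _ => c n := by
  intro ε hε
  refine tendsto_const_nhds.congr' ((hc.eventually_lt_const hε).mono fun n hn => ?_)
  simp [not_le.2 hn]

theorem isLittleOP_finsetSum {ι : Type*} {s : Finset ι} {Y : ι → ℕ → Ω → ℝ≥0∞}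
    (h : ∀ i ∈ s, IsLittleOP P (Y i)) : IsLittleOP P fun n ω => ∑ i ∈ s, Y i n ω := by
  classical
  induction s using Finset.induction_on with
  | empty => simpa using isLittleOP_of_tendsto (P := P) (c := fun _ => 0) tendsto_const_nhds
  | insert a s ha ih =>
    simp only [Finset.sum_insert ha]
    exact (h a (Finset.mem_insert_self a s)).add
      (ih fun i hi => h i (Finset.mem_insert_of_mem hi))

theorem IsLittleOP.const_mul (hY : IsLittleOP P Y) {c : ℝ≥0∞} (hc : c ≠ ∞) :
    IsLittleOP P fun n ω => c * Y n ω := by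
  intro ε hε
  refine tendsto_of_tendsto_of_tendsto_of_le_of_le tendsto_const_nhds
    (hY (ε / c) (ENNReal.div_pos hε.ne' hc)) (fun _ => zero_le)
    fun n => measure_mono fun ω hω => ENNReal.div_le_of_le_mul' hω

theorem isLittleOP_of_ne_top (h : ∀ ε : ℝ≥0∞, 0 < ε → ε ≠ ∞ →
    Tendsto (fun n => P {ω | ε ≤ Y n ω}) atTop (𝓝 0)) : IsLittleOP P Y := by
  intro ε hε
  refine tendsto_of_tendsto_of_tendsto_of_le_of_le tendsto_const_nhds
    (h (min ε 1) (lt_min hε one_pos) (ne_top_of_le_ne_top ENNReal.one_ne_top (min_le_right _ _)))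
    (fun _ => zero_le) fun n => measure_mono fun ω hω => (min_le_left ε 1).trans hω

theorem eLpNorm_two_sq {α : Type*} [MeasurableSpace α] (f : α → ℝ) (ν : Measure α) :
    eLpNorm f 2 ν ^ 2 = ∫⁻ z, ‖f z‖ₑ ^ 2 ∂ν := by
  rw [eLpNorm_eq_lintegral_rpow_enorm_toReal (by norm_num) (by norm_num), ← ENNReal.rpow_natCast,
    ← ENNReal.rpow_mul]
  norm_num

/-- Chebyshev's inequality for random elements of `L²(ν)`. -/
theorem isLittleOP_eLpNorm_of_integral_sq_le [IsProbabilityMeasure P] {α : Type*}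
    [MeasurableSpace α] {ν : Measure α} [IsFiniteMeasure ν] {D : ℕ → Ω → α → ℝ}
    (hD : ∀ n, Measurable (Function.uncurry (D n))) (hb : ∀ n, ∃ M : ℝ, ∀ ω z, |D n ω z| ≤ M)
    {c : ℕ → ℝ} (hc : Tendsto c atTop (𝓝 0)) (h : ∀ n z, ∫ ω, D n ω z ^ 2 ∂P ≤ c n) :
    IsLittleOP P fun n ω => eLpNorm (D n ω) 2 ν := by
  refine isLittleOP_of_ne_top fun ε hε hε' => ?_
  have hmeas : ∀ n, Measurable fun u : Ω × α => ‖D n u.1 u.2‖ₑ ^ 2 := fun n =>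
    ((hD n).enorm).pow_const 2
  have hz : ∀ n z, ∫⁻ ω, ‖D n ω z‖ₑ ^ 2 ∂P ≤ ENNReal.ofReal (c n) := by
    intro n z
    obtain ⟨M, hM⟩ := hb n
    have hDz : Measurable fun ω => D n ω z := (hD n).comp measurable_prodMk_right
    have hint : Integrable (fun ω => D n ω z ^ 2) P :=
      (MemLp.of_bound hDz.aestronglyMeasurable M
        (Eventually.of_forall fun ω => hM ω z)).integrable_sq
    refine le_trans (le_of_eq ?_) (ENNReal.ofReal_le_ofReal (h n z))
    rw [ofReal_integral_eq_lintegral_ofReal hint (Eventually.of_forall fun ω => sq_nonneg _)]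
    refine lintegral_congr fun ω => ?_
    rw [← ofReal_norm, ← ENNReal.ofReal_pow (norm_nonneg _), Real.norm_eq_abs, sq_abs]
  -- Markov's inequality for the squared norm, then Tonelli to use the pointwise second moments.
  -- Dividing by `ε ^ 2` is why `ε` was made finite.
  have hle : ∀ n, P {ω | ε ≤ eLpNorm (D n ω) 2 ν} ≤
      (ENNReal.ofReal (c n) * ν Set.univ) / ε ^ 2 := by
    intro n
    rw [ENNReal.le_div_iff_mul_le (Or.inl (ENNReal.pow_pos hε 2).ne')
      (Or.inl (ENNReal.pow_ne_top hε')),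
      mul_comm]
    calc ε ^ 2 * P {ω | ε ≤ eLpNorm (D n ω) 2 ν}
        ≤ ε ^ 2 * P {ω | ε ^ 2 ≤ ∫⁻ z, ‖D n ω z‖ₑ ^ 2 ∂ν} := by
          refine mul_le_mul_right (measure_mono fun ω hω => ?_) _
          rw [Set.mem_ofPred_eq, ← eLpNorm_two_sq]
          exact pow_le_pow_left' hω 2
      _ ≤ ∫⁻ ω, ∫⁻ z, ‖D n ω z‖ₑ ^ 2 ∂ν ∂P :=
          mul_meas_ge_le_lintegral (hmeas n).lintegral_prod_right' _
      _ = ∫⁻ z, ∫⁻ ω, ‖D n ω z‖ₑ ^ 2 ∂P ∂ν := lintegral_lintegral_swap (hmeas n).aemeasurable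
      _ ≤ ∫⁻ _, ENNReal.ofReal (c n) ∂ν := lintegral_mono (hz n)
      _ = _ := lintegral_const _
  refine tendsto_of_tendsto_of_tendsto_of_le_of_le tendsto_const_nhds ?_
    (fun _ => zero_le) hle
  have h1 := ENNReal.tendsto_ofReal hc
  rw [ENNReal.ofReal_zero] at h1
  have h2 := ENNReal.Tendsto.div_const (ENNReal.Tendsto.mul_const (b := ν Set.univ) h1
    (Or.inr (measure_ne_top ν _))) (b := ε ^ 2) (Or.inr (ENNReal.pow_pos hε 2).ne')
  simpa using h2

end LittleOP

/-! ### Second moment of an average of nearly uncorrelated variables -/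

section SecondMoment

variable {Ω : Type*} [MeasurableSpace Ω] {P : Measure Ω} [IsProbabilityMeasure P]

/-- Of the `n²` products only those with `s = t`, `s = t + k` or `t = s + k` contribute: at most
`3n` pairs, each with integral at most 1. -/
theorem integral_sq_average_le {D : ℕ → Ω → ℝ} (hD : ∀ t, Measurable (D t))
    (hb : ∀ t ω, |D t ω| ≤ 1) (k : ℕ)
    (h : ∀ t s, s ≠ t → s ≠ t + k → t ≠ s + k → ∫ ω, D t ω * D s ω ∂P = 0) (n : ℕ) :
    ∫ ω, ((n : ℝ)⁻¹ * ∑ t ∈ Finset.Icc 1 n, D t ω) ^ 2 ∂P ≤ 3 * (n : ℝ)⁻¹ := by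
  have hint : ∀ t s, Integrable (fun ω => D t ω * D s ω) P := fun t s =>
    Integrable.of_bound ((hD t).mul (hD s)).aestronglyMeasurable 1
      (Eventually.of_forall fun ω => by
        rw [Real.norm_eq_abs, abs_mul]
        exact mul_le_one₀ (hb t ω) (abs_nonneg _) (hb s ω))
  have hone : ∀ t s, ∫ ω, D t ω * D s ω ∂P ≤
      (if s = t then 1 else 0) + (if s = t + k then 1 else 0) + if t = s + k then 1 else 0 := by
    intro t s
    by_cases hts : s ≠ t ∧ s ≠ t + k ∧ t ≠ s + k
    · rw [h t s hts.1 hts.2.1 hts.2.2]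
      positivity
    have h1 : ∫ ω, D t ω * D s ω ∂P ≤ 1 := by
      have := norm_integral_le_of_norm_le_const (μ := P) (C := 1)
        (f := fun ω => D t ω * D s ω) (Eventually.of_forall fun ω => by
          rw [Real.norm_eq_abs, abs_mul]
          exact mul_le_one₀ (hb t ω) (abs_nonneg _) (hb s ω))
      simpa using (le_abs_self _).trans this
    refine h1.trans ?_
    split_ifs <;> first | norm_num; done | exact absurd ⟨‹_›, ‹_›, ‹_›⟩ hts
  have hexp : ∫ ω, ((n : ℝ)⁻¹ * ∑ t ∈ Finset.Icc 1 n, D t ω) ^ 2 ∂P =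
      ((n : ℝ)⁻¹) ^ 2 * ∑ t ∈ Finset.Icc 1 n, ∑ s ∈ Finset.Icc 1 n, ∫ ω, D t ω * D s ω ∂P := by
    simp only [mul_pow]
    rw [integral_const_mul]
    congr 1
    simp only [pow_two, Finset.sum_mul_sum]
    rw [integral_finsetSum _ fun t _ => integrable_finsetSum _ fun s _ => hint t s]
    exact Finset.sum_congr rfl fun t _ => integral_finsetSum _ fun s _ => hint t s
  have hite : ∀ m : ℕ, (∑ s ∈ Finset.Icc 1 n, if s = m then (1 : ℝ) else 0) ≤ 1 := by
    intro m
    rw [Finset.sum_ite_eq']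
    split_ifs <;> norm_num
  have hcount : ∑ t ∈ Finset.Icc 1 n, ∑ s ∈ Finset.Icc 1 n, ∫ ω, D t ω * D s ω ∂P ≤ 3 * n := by
    calc _ ≤ ∑ t ∈ Finset.Icc 1 n, ∑ s ∈ Finset.Icc 1 n, ((if s = t then (1 : ℝ) else 0) +
          (if s = t + k then 1 else 0) + if t = s + k then 1 else 0) :=
        Finset.sum_le_sum fun t _ => Finset.sum_le_sum fun s _ => hone t s
      _ = (∑ t ∈ Finset.Icc 1 n, ∑ s ∈ Finset.Icc 1 n, if s = t then (1 : ℝ) else 0) +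
          (∑ t ∈ Finset.Icc 1 n, ∑ s ∈ Finset.Icc 1 n, if s = t + k then (1 : ℝ) else 0) +
          ∑ s ∈ Finset.Icc 1 n, ∑ t ∈ Finset.Icc 1 n, if t = s + k then (1 : ℝ) else 0 := by
        simp only [Finset.sum_add_distrib]
        congr 1
        exact Finset.sum_comm
      _ ≤ (∑ t ∈ Finset.Icc 1 n, 1) + (∑ t ∈ Finset.Icc 1 n, 1) + ∑ t ∈ Finset.Icc 1 n, 1 := by
        gcongr <;> exact hite _
      _ = 3 * n := by simp; ring
  rw [hexp]
  refine (mul_le_mul_of_nonneg_left hcount (by positivity)).trans (le_of_eq ?_)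
  rcases eq_or_ne (n : ℝ) 0 with hn | hn
  · simp [hn]
  · field_simp

end SecondMoment

/-! ### Bounds for numbers in the unit interval and for empirical distribution functions -/

section UnitInterval

theorem abs_sub_le_one_of_mem_Icc {a b : ℝ} (ha : a ∈ Set.Icc (0 : ℝ) 1)
    (hb : b ∈ Set.Icc (0 : ℝ) 1) : |a - b| ≤ 1 := by
  rw [abs_le]
  constructor <;> linarith [ha.1, ha.2, hb.1, hb.2]

theorem mul_mem_unitInterval {a b : ℝ} (ha : a ∈ Set.Icc (0 : ℝ) 1)
    (hb : b ∈ Set.Icc (0 : ℝ) 1) : a * b ∈ Set.Icc (0 : ℝ) 1 :=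
  ⟨mul_nonneg ha.1 hb.1, mul_le_one₀ ha.2 hb.1 hb.2⟩

theorem abs_average_le_one {n : ℕ} {f : ℕ → ℝ} (h : ∀ t, |f t| ≤ 1) :
    |(n : ℝ)⁻¹ * ∑ t ∈ Finset.Icc 1 n, f t| ≤ 1 := by
  rw [abs_mul, abs_of_nonneg (by positivity)]
  have h1 : |∑ t ∈ Finset.Icc 1 n, f t| ≤ n := by
    refine (Finset.abs_sum_le_sum_abs _ _).trans ((Finset.sum_le_sum fun t _ => h t).trans ?_)
    simp
  exact (mul_le_mul_of_nonneg_left h1 (by positivity)).trans inv_mul_le_one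

theorem abs_prod_le_one {ι : Type*} {s : Finset ι} {f : ι → ℝ}
    (h : ∀ i, f i ∈ Set.Icc (0 : ℝ) 1) : |∏ i ∈ s, f i| ≤ 1 := by
  rw [abs_of_nonneg (Finset.prod_nonneg fun i _ => (h i).1)]
  exact Finset.prod_le_one (fun i _ => (h i).1) fun i _ => (h i).2

end UnitInterval

section Empirical

variable {Ω : Type*} {X : ℝ≥0 → Ω → ℝ} {S : SamplingScheme}

theorem empCDF_mem (X : ℝ≥0 → Ω → ℝ) (S : SamplingScheme) (t : ℕ) (ω : Ω) (x : ℝ) :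
    empCDF X S t ω x ∈ Set.Icc (0 : ℝ) 1 := by
  have hq : (0 : ℝ) < S.q t := Nat.cast_pos.2 (S.q_pos t)
  refine ⟨mul_nonneg (by positivity) (Finset.sum_nonneg fun i _ =>
    Set.indicator_nonneg (fun _ _ => zero_le_one) _), ?_⟩
  rw [empCDF, inv_mul_le_iff₀ hq, mul_one]
  refine (Finset.sum_le_card_nsmul _ _ 1 fun i _ =>
    Set.indicator_le_self' (fun _ _ => zero_le_one) _).trans (by simp)

theorem measurable_uncurry_empCDF [MeasurableSpace Ω] (hX : ∀ τ, Measurable (X τ))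
    (S : SamplingScheme) (t : ℕ) : Measurable fun u : Ω × ℝ => empCDF X S t u.1 u.2 := by
  refine Measurable.const_mul (Finset.measurable_sum _ fun i _ => ?_) _
  exact Measurable.ite (measurableSet_le ((hX _).comp measurable_fst) measurable_snd)
    measurable_const measurable_const

end Empirical

/-! ### Conditional independence across cycles and the law of large numbers -/

section CyclicIndependence

theorem measurable_measureReal_coe {B : Set ℝ} (hB : MeasurableSet B) :
    Measurable fun ν : ProbabilityMeasure ℝ => (ν : Measure ℝ).real B :=
  ((Measure.measurable_coe hB).comp measurable_subtype_coe).ennreal_toReal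

theorem measurable_latentCDF_latentSigma {Ω : Type*} (ξ : ℕ → Ω → ProbabilityMeasure ℝ)
    (t : ℕ) (x : ℝ) : Measurable[latentSigma ξ] fun ω => latentCDF ξ t ω x := by
  have h2 : Measurable[latentSigma ξ] (ξ t) :=
    (comap_measurable (ξ t)).mono (le_iSup (fun t => MeasurableSpace.comap (ξ t) _) t) le_rfl
  exact (measurable_measureReal_coe measurableSet_Iic).comp h2

variable {Ω : Type*} [MeasurableSpace Ω] {P : Measure Ω} [IsProbabilityMeasure P]
  {ξ : ℕ → Ω → ProbabilityMeasure ℝ} {X : ℝ≥0 → Ω → ℝ}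

theorem latentSigma_le (hξ : ∀ t, Measurable (ξ t)) :
    latentSigma ξ ≤ (inferInstance : MeasurableSpace Ω) :=
  iSup_le fun t => (hξ t).comap_le

/-- Condition on `Ξ`: the factor `Z` comes out, and the indicator of the intersection has
conditional expectation `∏ F_t(x_t)` by cyclic independence and compatibility. -/
theorem integral_mul_prod_indicator (hconj : IsConjugateProcess P ξ X)
    (hcyc : IsCyclicIndependent P ξ X) (s : Finset ℕ) (x : ℕ → ℝ) {τ : ℕ → ℝ≥0}
    (hτ : ∀ t ∈ s, τ t ∈ Set.Ico (t : ℝ≥0) (t + 1)) {Z : Ω → ℝ}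
    (hZ : Measurable[latentSigma ξ] Z) {M : ℝ} (hM : ∀ ω, |Z ω| ≤ M) :
    ∫ ω, Z ω * ∏ t ∈ s, (Set.Iic (x t)).indicator (fun _ => (1 : ℝ)) (X (τ t) ω) ∂P =
      ∫ ω, Z ω * ∏ t ∈ s, latentCDF ξ t ω (x t) ∂P := by
  have hle := latentSigma_le hconj.measurable_latent
  let A : ℕ → Set Ω := fun t => X (τ t) ⁻¹' Set.Iic (x t)
  have hA : ∀ t, MeasurableSet (A t) := fun t => hconj.measurable_obs _ measurableSet_Iic
  have hAc : ∀ t ∈ s, MeasurableSet[cycleSigma X t] (A t) := fun t ht => by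
    have h1 : MeasurableSpace.comap (X (τ t)) inferInstance ≤ cycleSigma X t :=
      le_iSup₂_of_le (f := fun τ (_ : τ ∈ Set.Ico (t : ℝ≥0) (t + 1)) =>
        MeasurableSpace.comap (X τ) inferInstance) (τ t) (hτ t ht) le_rfl
    exact h1 _ ⟨_, measurableSet_Iic, rfl⟩
  let B : Set Ω := ⋂ t ∈ s, A t
  have hB : MeasurableSet B := s.measurableSet_biInter fun t _ => hA t
  have hprod : ∀ ω, ∏ t ∈ s, (Set.Iic (x t)).indicator (fun _ => (1 : ℝ)) (X (τ t) ω) =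
      B.indicator (fun _ => (1 : ℝ)) ω := by
    intro ω
    by_cases hω : ω ∈ B
    · rw [Set.indicator_of_mem hω]
      exact Finset.prod_eq_one fun t ht =>
        Set.indicator_of_mem (show X (τ t) ω ∈ Set.Iic (x t) from Set.mem_iInter₂.1 hω t ht) _
    · rw [Set.indicator_of_notMem hω]
      obtain ⟨t, ht, hωt⟩ : ∃ t ∈ s, ω ∉ A t := by
        simpa only [B, Set.mem_iInter, not_forall, exists_prop] using hω
      exact Finset.prod_eq_zero ht (Set.indicator_of_notMem (s := Set.Iic (x t)) hωt _)
  have hcond : P⟦B | latentSigma ξ⟧ =ᵐ[P] fun ω => ∏ t ∈ s, latentCDF ξ t ω (x t) := by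
    have h1 : ∀ᵐ ω ∂P, ∀ t ∈ s, (P⟦A t | latentSigma ξ⟧) ω = latentCDF ξ t ω (x t) :=
      (ae_ball_iff s.countable_toSet).2 fun t ht =>
        hconj.compat t (τ t) (hτ t ht) _ measurableSet_Iic
    filter_upwards [hcyc s A hAc, h1] with ω h2 h3
    rw [h2, Finset.prod_apply]
    exact Finset.prod_congr rfl h3
  have hind : Integrable (B.indicator fun _ => (1 : ℝ)) P :=
    (integrable_const (1 : ℝ)).indicator hB
  have hmul : Integrable (Z * B.indicator fun _ => (1 : ℝ)) P :=
    hind.bdd_mul (hZ.mono hle le_rfl).aestronglyMeasurable (c := M) (Eventually.of_forall hM)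
  simp only [hprod]
  calc ∫ ω, Z ω * B.indicator (fun _ => (1 : ℝ)) ω ∂P
      = ∫ ω, (P[Z * B.indicator fun _ => (1 : ℝ) | latentSigma ξ]) ω ∂P :=
        (integral_condExp hle).symm
    _ = ∫ ω, Z ω * ∏ t ∈ s, latentCDF ξ t ω (x t) ∂P := by
        refine integral_congr_ae ?_
        filter_upwards [condExp_mul_of_stronglyMeasurable_left hZ.stronglyMeasurable hmul hind,
          hcond] with ω h1 h2
        rw [h1, Pi.mul_apply, h2]

/-- A product of averages is the average over all choices of one observation per cycle. Each term
involves every cycle only once, so dependence within a cycle plays no role. -/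
theorem integral_mul_prod_empCDF (hconj : IsConjugateProcess P ξ X)
    (hcyc : IsCyclicIndependent P ξ X) (S : SamplingScheme) (s : Finset ℕ) (x : ℕ → ℝ)
    {Z : Ω → ℝ} (hZ : Measurable[latentSigma ξ] Z) {M : ℝ} (hM : ∀ ω, |Z ω| ≤ M) :
    ∫ ω, Z ω * ∏ t ∈ s, empCDF X S t ω (x t) ∂P =
      ∫ ω, Z ω * ∏ t ∈ s, latentCDF ξ t ω (x t) ∂P := by
  have hle := latentSigma_le hconj.measurable_latent
  -- Observation times selected by `f`; the value off `s` is a dummy.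
  let I : (∀ t : s, Fin (S.q t)) → ℕ → ℝ≥0 := fun f t =>
    if ht : t ∈ s then S.time t (f ⟨t, ht⟩) else t
  have hI : ∀ f, ∀ t ∈ s, I f t ∈ Set.Ico (t : ℝ≥0) (t + 1) := fun f t ht => by
    simp only [I, dif_pos ht]
    exact S.time_mem t _
  have hexp : ∀ ω, ∏ t ∈ s, empCDF X S t ω (x t) = (∏ t ∈ s, (S.q t : ℝ)⁻¹) *
      ∑ f : (∀ t : s, Fin (S.q t)),
        ∏ t ∈ s, (Set.Iic (x t)).indicator (fun _ => (1 : ℝ)) (X (I f t) ω) := by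
    intro ω
    simp only [empCDF]
    rw [Finset.prod_mul_distrib]
    congr 1
    rw [← Finset.prod_coe_sort, Finset.prod_univ_sum]
    refine Finset.sum_congr (by simp) fun f _ => ?_
    rw [← Finset.prod_coe_sort s fun t =>
      (Set.Iic (x t)).indicator (fun _ => (1 : ℝ)) (X (I f t) ω)]
    refine Finset.prod_congr rfl fun t _ => ?_
    simp [I]
  have hint : ∀ f : (∀ t : s, Fin (S.q t)), Integrable (fun ω =>
      Z ω * ∏ t ∈ s, (Set.Iic (x t)).indicator (fun _ => (1 : ℝ)) (X (I f t) ω)) P := by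
    intro f
    have hm : Measurable fun ω =>
        ∏ t ∈ s, (Set.Iic (x t)).indicator (fun _ => (1 : ℝ)) (X (I f t) ω) :=
      Finset.measurable_prod _ fun t _ =>
        (measurable_const.indicator measurableSet_Iic).comp (hconj.measurable_obs _)
    refine Integrable.bdd_mul ?_ (hZ.mono hle le_rfl).aestronglyMeasurable (c := M)
      (Eventually.of_forall hM)
    refine Integrable.of_bound hm.aestronglyMeasurable 1 (Eventually.of_forall fun ω => ?_)
    refine abs_prod_le_one fun t => ?_
    by_cases h : X (I f t) ω ∈ Set.Iic (x t) <;> simp [Set.indicator, h]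
  have hq : (∏ t ∈ s, (S.q t : ℝ)⁻¹) * (Fintype.card (∀ t : s, Fin (S.q t)) : ℝ) = 1 := by
    rw [Fintype.card_pi, Finset.prod_coe_sort s fun t => Fintype.card (Fin (S.q t)),
      Nat.cast_prod, ← Finset.prod_mul_distrib]
    refine Finset.prod_eq_one fun t _ => ?_
    rw [Fintype.card_fin]
    exact inv_mul_cancel₀ (Nat.cast_ne_zero.2 (S.q_pos t).ne')
  calc ∫ ω, Z ω * ∏ t ∈ s, empCDF X S t ω (x t) ∂P
      = ∫ ω, (∏ t ∈ s, (S.q t : ℝ)⁻¹) * ∑ f : (∀ t : s, Fin (S.q t)),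
          Z ω * ∏ t ∈ s, (Set.Iic (x t)).indicator (fun _ => (1 : ℝ)) (X (I f t) ω) ∂P := by
        refine integral_congr_ae (Eventually.of_forall fun ω => ?_)
        simp only [hexp, Finset.mul_sum]
        exact Finset.sum_congr rfl fun f _ => by ring
    _ = (∏ t ∈ s, (S.q t : ℝ)⁻¹) * ∑ f : (∀ t : s, Fin (S.q t)),
          ∫ ω, Z ω * ∏ t ∈ s, latentCDF ξ t ω (x t) ∂P := by
        rw [integral_const_mul, integral_finsetSum _ fun f _ => hint f]
        congr 1
        exact Finset.sum_congr rfl fun f _ =>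
          integral_mul_prod_indicator hconj hcyc s x (hI f) hZ hM
    _ = _ := by
        rw [Finset.sum_const, Finset.card_univ, nsmul_eq_mul, ← mul_assoc, hq, one_mul]

/-- The errors of products of empirical distribution functions over disjoint sets of cycles are
uncorrelated. -/
theorem integral_prod_sub_mul_prod_sub_eq_zero (hconj : IsConjugateProcess P ξ X)
    (hcyc : IsCyclicIndependent P ξ X) (S : SamplingScheme) {u v : Finset ℕ}
    (huv : Disjoint u v) (x : ℕ → ℝ) :
    ∫ ω, (∏ t ∈ u, empCDF X S t ω (x t) - ∏ t ∈ u, latentCDF ξ t ω (x t)) *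
      (∏ t ∈ v, empCDF X S t ω (x t) - ∏ t ∈ v, latentCDF ξ t ω (x t)) ∂P = 0 := by
  have hle := latentSigma_le hconj.measurable_latent
  have hGm : ∀ s : Finset ℕ, Measurable fun ω => ∏ t ∈ s, empCDF X S t ω (x t) := fun s =>
    Finset.measurable_prod _ fun t _ =>
      (measurable_uncurry_empCDF hconj.measurable_obs S t).comp measurable_prodMk_right
  have hFm : ∀ s : Finset ℕ, Measurable[latentSigma ξ] fun ω => ∏ t ∈ s, latentCDF ξ t ω (x t) :=
    fun s => Finset.measurable_prod _ fun t _ => measurable_latentCDF_latentSigma ξ t (x t)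
  have hGb : ∀ (s : Finset ℕ) ω, |∏ t ∈ s, empCDF X S t ω (x t)| ≤ 1 := fun s ω =>
    abs_prod_le_one fun t => empCDF_mem X S t ω (x t)
  have hFb : ∀ (s : Finset ℕ) ω, |∏ t ∈ s, latentCDF ξ t ω (x t)| ≤ 1 := fun s ω =>
    abs_prod_le_one fun t => latentCDF_mem ξ t ω (x t)
  have hGi : ∀ s : Finset ℕ, Integrable (fun ω => ∏ t ∈ s, empCDF X S t ω (x t)) P := fun s =>
    Integrable.of_bound (hGm s).aestronglyMeasurable 1 (Eventually.of_forall (hGb s))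
  have hFi : ∀ s : Finset ℕ, Integrable (fun ω => ∏ t ∈ s, latentCDF ξ t ω (x t)) P := fun s =>
    Integrable.of_bound ((hFm s).mono hle le_rfl).aestronglyMeasurable 1
      (Eventually.of_forall (hFb s))
  have hFG : ∀ s s' : Finset ℕ, Integrable (fun ω => (∏ t ∈ s, latentCDF ξ t ω (x t)) *
      ∏ t ∈ s', empCDF X S t ω (x t)) P := fun s s' =>
    (hGi s').bdd_mul ((hFm s).mono hle le_rfl).aestronglyMeasurable (c := 1)
      (Eventually.of_forall (hFb s))
  have h1 := integral_mul_prod_empCDF hconj hcyc S (u ∪ v) x (Z := fun _ => 1)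
    measurable_const (M := 1) (by simp)
  have h2 := integral_mul_prod_empCDF hconj hcyc S u x (hFm v) (hFb v)
  have h3 := integral_mul_prod_empCDF hconj hcyc S v x (hFm u) (hFb u)
  simp only [one_mul, Finset.prod_union huv] at h1
  have hu := hGi (u ∪ v)
  have hv := hFi (u ∪ v)
  simp only [Finset.prod_union huv] at hu hv
  -- All four terms of the expanded product have the same expectation, that of the product of the
  -- latent factors over `u` and `v`.
  have hsplit : ∀ ω, (∏ t ∈ u, empCDF X S t ω (x t) - ∏ t ∈ u, latentCDF ξ t ω (x t)) *
      (∏ t ∈ v, empCDF X S t ω (x t) - ∏ t ∈ v, latentCDF ξ t ω (x t)) =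
      ((∏ t ∈ u, empCDF X S t ω (x t)) * (∏ t ∈ v, empCDF X S t ω (x t)) -
        (∏ t ∈ v, latentCDF ξ t ω (x t)) * ∏ t ∈ u, empCDF X S t ω (x t)) -
      ((∏ t ∈ u, latentCDF ξ t ω (x t)) * (∏ t ∈ v, empCDF X S t ω (x t)) -
        (∏ t ∈ u, latentCDF ξ t ω (x t)) * ∏ t ∈ v, latentCDF ξ t ω (x t)) := fun ω => by ring
  simp only [hsplit]
  have hd1 : Integrable (fun ω =>
      (∏ t ∈ u, empCDF X S t ω (x t)) * (∏ t ∈ v, empCDF X S t ω (x t)) -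
        (∏ t ∈ v, latentCDF ξ t ω (x t)) * ∏ t ∈ u, empCDF X S t ω (x t)) P := hu.sub (hFG v u)
  have hd2 : Integrable (fun ω =>
      (∏ t ∈ u, latentCDF ξ t ω (x t)) * (∏ t ∈ v, empCDF X S t ω (x t)) -
        (∏ t ∈ u, latentCDF ξ t ω (x t)) * ∏ t ∈ v, latentCDF ξ t ω (x t)) P := (hFG u v).sub hv
  rw [integral_sub hd1 hd2, integral_sub hu (hFG v u),
    integral_sub (hFG u v) hv, h1, h2, h3]
  simp only [mul_comm, sub_self]

theorem isLittleOP_average_empCDF_sub (hconj : IsConjugateProcess P ξ X)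
    (hcyc : IsCyclicIndependent P ξ X) (S : SamplingScheme) (μ : Measure ℝ) [IsFiniteMeasure μ] :
    IsLittleOP P fun n ω => eLpNorm (fun x : ℝ =>
      (n : ℝ)⁻¹ * ∑ t ∈ Finset.Icc 1 n, (empCDF X S t ω x - latentCDF ξ t ω x)) 2 μ := by
  have hm : ∀ t, Measurable fun u : Ω × ℝ => empCDF X S t u.1 u.2 - latentCDF ξ t u.1 u.2 :=
    fun t => (measurable_uncurry_empCDF hconj.measurable_obs S t).sub
      (measurable_latentCDF hconj.measurable_latent t)
  have hb : ∀ t ω x, |empCDF X S t ω x - latentCDF ξ t ω x| ≤ 1 := fun t ω x =>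
    abs_sub_le_one_of_mem_Icc (empCDF_mem X S t ω x) (latentCDF_mem ξ t ω x)
  refine isLittleOP_eLpNorm_of_integral_sq_le
    (D := fun n ω x => (n : ℝ)⁻¹ * ∑ t ∈ Finset.Icc 1 n, (empCDF X S t ω x - latentCDF ξ t ω x))
    (fun n => (Finset.measurable_sum _ fun t _ => hm t).const_mul _)
    (fun n => ⟨_, fun ω x => abs_average_le_one fun t => hb t ω x⟩)
    (c := fun n => 3 * (n : ℝ)⁻¹)
    (by simpa using (tendsto_inv_atTop_nhds_zero_nat (𝕜 := ℝ)).const_mul 3) fun n x => ?_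
  -- At lag 0 the three exceptional cases all reduce to `s = t`.
  refine integral_sq_average_le (fun t => (hm t).comp measurable_prodMk_right)
    (fun t ω => hb t ω x) 0 (fun t s hst _ _ => ?_) n
  simpa using integral_prod_sub_mul_prod_sub_eq_zero hconj hcyc S
    (u := {t}) (v := {s}) (by simpa using hst.symm) fun _ => x

theorem isLittleOP_average_empCDF_mul_sub (hconj : IsConjugateProcess P ξ X)
    (hcyc : IsCyclicIndependent P ξ X) (S : SamplingScheme) (μ : Measure ℝ) [IsFiniteMeasure μ]
    {k : ℕ} (hk : 1 ≤ k) :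
    IsLittleOP P fun n ω => eLpNorm (fun z : ℝ × ℝ =>
      (n : ℝ)⁻¹ * ∑ t ∈ Finset.Icc 1 n, (empCDF X S t ω z.1 * empCDF X S (t + k) ω z.2 -
        latentCDF ξ t ω z.1 * latentCDF ξ (t + k) ω z.2)) 2 (μ.prod μ) := by
  have h1 : Measurable fun u : Ω × ℝ × ℝ => (u.1, u.2.1) := by fun_prop
  have h2 : Measurable fun u : Ω × ℝ × ℝ => (u.1, u.2.2) := by fun_prop
  have hm : ∀ t, Measurable fun u : Ω × ℝ × ℝ =>
      empCDF X S t u.1 u.2.1 * empCDF X S (t + k) u.1 u.2.2 -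
        latentCDF ξ t u.1 u.2.1 * latentCDF ξ (t + k) u.1 u.2.2 :=
    fun t => (((measurable_uncurry_empCDF hconj.measurable_obs S t).comp h1).mul
      ((measurable_uncurry_empCDF hconj.measurable_obs S (t + k)).comp h2)).sub
      (((measurable_latentCDF hconj.measurable_latent t).comp h1).mul
      ((measurable_latentCDF hconj.measurable_latent (t + k)).comp h2))
  have hb : ∀ t ω (z : ℝ × ℝ), |empCDF X S t ω z.1 * empCDF X S (t + k) ω z.2 -
        latentCDF ξ t ω z.1 * latentCDF ξ (t + k) ω z.2| ≤ 1 := fun t ω z =>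
    abs_sub_le_one_of_mem_Icc
      (mul_mem_unitInterval (empCDF_mem X S t ω z.1) (empCDF_mem X S (t + k) ω z.2))
      (mul_mem_unitInterval (latentCDF_mem ξ t ω z.1) (latentCDF_mem ξ (t + k) ω z.2))
  refine isLittleOP_eLpNorm_of_integral_sq_le
    (D := fun n ω (z : ℝ × ℝ) => (n : ℝ)⁻¹ * ∑ t ∈ Finset.Icc 1 n,
      (empCDF X S t ω z.1 * empCDF X S (t + k) ω z.2 -
        latentCDF ξ t ω z.1 * latentCDF ξ (t + k) ω z.2))
    (fun n => (Finset.measurable_sum _ fun t _ => hm t).const_mul _)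
    (fun n => ⟨_, fun ω z => abs_average_le_one fun t => hb t ω z⟩)
    (c := fun n => 3 * (n : ℝ)⁻¹)
    (by simpa using (tendsto_inv_atTop_nhds_zero_nat (𝕜 := ℝ)).const_mul 3) fun n z => ?_
  refine integral_sq_average_le (fun t => (hm t).comp measurable_prodMk_right)
    (fun t ω => hb t ω z) k (fun t s hst hst' hts' => ?_) n
  -- The argument is `z.1` in the leading cycles `t`, `s` and `z.2` in `t + k`, `s + k`. This is
  -- consistent because `k ≥ 1` and the excluded coincidences keep the four indices distinct.
  have h := integral_prod_sub_mul_prod_sub_eq_zero hconj hcyc S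
    (u := {t, t + k}) (v := {s, s + k}) (by
      simp only [Finset.disjoint_insert_left, Finset.disjoint_singleton_left, Finset.mem_insert,
        Finset.mem_singleton]
      omega) fun i => if i = t ∨ i = s then z.1 else z.2
  have hpair : ∀ (a : ℕ) (g : ℕ → ℝ), ∏ i ∈ {a, a + k}, g i = g a * g (a + k) := fun a g =>
    Finset.prod_pair (by omega)
  have hk0 : k ≠ 0 := by omega
  simpa [hpair, hk0, hst', hst'.symm, hts', hts'.symm] using h

end CyclicIndependence

/-! ### From weak convergence to convergence of distribution functions in `L²(μ)` -/

section LevyProkhorov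

/-- Thickening a half-line by `c` moves its endpoint by `c`, and the `ν₀`-mass in between lies in
the ball around `x`. The bound involves only `ν₀`, so it does not depend on the random measure. -/
theorem abs_measureReal_Iic_sub_le {ν ν₀ : Measure ℝ} [IsFiniteMeasure ν] [IsFiniteMeasure ν₀]
    {c : ℝ} (hc : 0 < c) (h : levyProkhorovEDist ν ν₀ < ENNReal.ofReal c) (x : ℝ) :
    |ν.real (Set.Iic x) - ν₀.real (Set.Iic x)| ≤ ν₀.real (Metric.closedBall x c) + c := by
  have hcr : (ENNReal.ofReal c).toReal = c := ENNReal.toReal_ofReal hc.le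
  have h1 : ν (Set.Iic x) ≤ ν₀ (Set.Iic x) + ν₀ (Metric.closedBall x c) + ENNReal.ofReal c := by
    refine (left_measure_le_of_levyProkhorovEDist_lt h measurableSet_Iic).trans ?_
    gcongr
    refine (measure_mono fun y hy => ?_).trans (measure_union_le _ _)
    obtain ⟨z, hz, hyz⟩ := Metric.mem_thickening_iff.1 hy
    rw [hcr, Real.dist_eq, abs_lt] at hyz
    rw [Set.mem_Iic] at hz
    rcases le_or_gt y x with hyx | hyx
    · exact Or.inl hyx
    · right
      rw [Metric.mem_closedBall, Real.dist_eq, abs_le]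
      constructor <;> linarith
  have h2 : ν₀ (Set.Iic x) ≤ ν (Set.Iic x) + ν₀ (Metric.closedBall x c) + ENNReal.ofReal c := by
    have h3 : ν₀ (Set.Iic x) ≤ ν₀ (Set.Iic (x - c)) + ν₀ (Metric.closedBall x c) := by
      refine (measure_mono fun y hy => ?_).trans (measure_union_le _ _)
      rw [Set.mem_Iic] at hy
      rcases le_or_gt y (x - c) with hyx | hyx
      · exact Or.inl hyx
      · right
        rw [Metric.mem_closedBall, Real.dist_eq, abs_le]
        constructor <;> linarith
    -- Starting from `x - c` places the thickened half-line inside `Set.Iic x`, so no ball mass of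
    -- `ν` appears.
    have h4 : ν₀ (Set.Iic (x - c)) ≤ ν (Set.Iic x) + ENNReal.ofReal c := by
      refine (right_measure_le_of_levyProkhorovEDist_lt h measurableSet_Iic).trans ?_
      gcongr
      intro y hy
      obtain ⟨z, hz, hyz⟩ := Metric.mem_thickening_iff.1 hy
      rw [hcr, Real.dist_eq, abs_lt] at hyz
      rw [Set.mem_Iic] at hz ⊢
      linarith
    refine h3.trans ((add_le_add_left h4 _).trans (le_of_eq ?_))
    ring
  have hreal : ∀ ν₁ ν₂ : Measure ℝ, IsFiniteMeasure ν₁ → IsFiniteMeasure ν₂ →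
      ν₁ (Set.Iic x) ≤ ν₂ (Set.Iic x) + ν₀ (Metric.closedBall x c) + ENNReal.ofReal c →
      ν₁.real (Set.Iic x) ≤ ν₂.real (Set.Iic x) + ν₀.real (Metric.closedBall x c) + c := by
    intro ν₁ ν₂ _ _ hle
    have h5 := ENNReal.toReal_mono (by finiteness) hle
    rwa [ENNReal.toReal_add (by finiteness) (by finiteness),
      ENNReal.toReal_add (by finiteness) (by finiteness), hcr] at h5
  rw [abs_le]
  constructor
  · linarith [hreal ν₀ ν inferInstance inferInstance h2]
  · linarith [hreal ν ν₀ inferInstance inferInstance h1]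

theorem measurable_measureReal_closedBall (ν : Measure ℝ) [IsFiniteMeasure ν] (c : ℝ) :
    Measurable fun x => ν.real (Metric.closedBall x c) := by
  have hs : MeasurableSet {u : ℝ × ℝ | dist u.2 u.1 ≤ c} :=
    measurableSet_le (by fun_prop) measurable_const
  exact (measurable_measure_prodMk_left hs).ennreal_toReal

/-- Under a measure without atoms, the mass of small balls of a finite measure is small in
mean square. -/
theorem tendsto_eLpNorm_measureReal_closedBall (ν μ : Measure ℝ) [IsFiniteMeasure ν]
    [IsFiniteMeasure μ] [NullSingletonClass μ] :
    Tendsto (fun m : ℕ => eLpNorm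
      (fun x => ν.real (Metric.closedBall x (1 / ((m : ℝ) + 1))) + 1 / ((m : ℝ) + 1)) 2 μ)
      atTop (𝓝 0) := by
  have hc : Tendsto (fun m : ℕ => 1 / ((m : ℝ) + 1)) atTop (𝓝 0) :=
    tendsto_one_div_add_atTop_nhds_zero_nat
  -- A finite measure has countably many atoms, and `μ` does not charge countable sets.
  have hae : ∀ᵐ x ∂μ, ν {x} = 0 := by
    have : {x | ν {x} ≠ 0}.Countable := by
      simpa [pos_iff_ne_zero] using Measure.countable_meas_pos_of_disjoint_iUnion (μ := ν)
        (As := fun x : ℝ => {x}) (fun x => measurableSet_singleton x)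
        (fun x y hxy => Set.disjoint_singleton.2 hxy)
    exact this.measure_zero μ
  have hsq : Tendsto (fun m : ℕ => ∫⁻ x,
      ‖ν.real (Metric.closedBall x (1 / ((m : ℝ) + 1))) + 1 / ((m : ℝ) + 1)‖ₑ ^ 2 ∂μ)
      atTop (𝓝 (∫⁻ _, 0 ∂μ)) := by
    refine tendsto_lintegral_of_dominated_convergence
      (fun _ => ENNReal.ofReal (ν.real Set.univ + 1) ^ 2) (fun m => ?_) (fun m => ?_) ?_ ?_
    · exact (((measurable_measureReal_closedBall ν _).add_const _).enorm).pow_const 2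
    · refine Eventually.of_forall fun x => ?_
      have h1 : 1 / ((m : ℝ) + 1) ≤ 1 := by
        rw [div_le_one (by positivity)]
        linarith [Nat.cast_nonneg (α := ℝ) m]
      have h2 : ν.real (Metric.closedBall x (1 / ((m : ℝ) + 1))) ≤ ν.real Set.univ :=
        measureReal_mono (Set.subset_univ _)
      dsimp only
      rw [Real.enorm_of_nonneg (by positivity)]
      gcongr
    · rw [lintegral_const]
      finiteness
    · filter_upwards [hae] with x hx
      have h1 := (tendsto_measure_cthickening_of_isCompact (μ := ν)
        (isCompact_singleton (x := x))).comp hc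
      rw [hx] at h1
      have h2 := (ENNReal.tendsto_toReal ENNReal.zero_ne_top).comp h1
      have h3 := ENNReal.Tendsto.pow (n := 2) (h2.add hc).enorm
      simp only [ENNReal.toReal_zero, add_zero, enorm_zero] at h3
      rw [zero_pow two_ne_zero] at h3
      refine h3.congr fun m => ?_
      simp only [Function.comp_apply, Metric.cthickening_singleton x
        (show (0 : ℝ) ≤ 1 / ((m : ℝ) + 1) by positivity)]
      rfl
  rw [lintegral_zero] at hsq
  simp only [← eLpNorm_two_sq] at hsq
  rw [ENNReal.tendsto_nhds_zero]
  intro ε hε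
  filter_upwards [ENNReal.tendsto_nhds_zero.1 hsq (ε ^ 2) (ENNReal.pow_pos hε 2)] with m hm
  exact (ENNReal.pow_le_pow_left_iff two_ne_zero).1 hm

variable {Ω : Type*} [MeasurableSpace Ω] {P : Measure Ω}
  {ξ : ℕ → Ω → ProbabilityMeasure ℝ}

theorem measurable_coe_latent (hξ : ∀ t, Measurable (ξ t)) (t : ℕ) :
    Measurable fun ω => (ξ t ω : Measure ℝ) :=
  measurable_subtype_coe.comp (hξ t)

theorem isProbabilityMeasure_barycenter [IsProbabilityMeasure P] (hξ : ∀ t, Measurable (ξ t))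
    (t : ℕ) : IsProbabilityMeasure (barycenter P (ξ t)) := by
  refine ⟨?_⟩
  rw [barycenter, Measure.bind_apply MeasurableSet.univ (measurable_coe_latent hξ t).aemeasurable]
  simp

theorem barycenter_real_Iic (hξ : ∀ t, Measurable (ξ t)) (t : ℕ) (x : ℝ) :
    (barycenter P (ξ t)).real (Set.Iic x) = ∫ ω, latentCDF ξ t ω x ∂P := by
  rw [measureReal_def, barycenter,
    Measure.bind_apply measurableSet_Iic (measurable_coe_latent hξ t).aemeasurable]
  refine (integral_toReal ?_ ?_).symm
  · exact ((Measure.measurable_coe measurableSet_Iic).comp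
      (measurable_coe_latent hξ t)).aemeasurable
  · exact Eventually.of_forall fun ω => measure_lt_top _ _

/-- Fix a radius whose ball-mass bound has `L²(μ)` norm below `ε`. A deviation of size `ε` then
forces the Lévy–Prokhorov distance to be at least that radius. -/
theorem isLittleOP_average_latentCDF_sub [IsProbabilityMeasure P] (hξ : ∀ t, Measurable (ξ t))
    (herg : IsErgodicInProbability P ξ) (μ : Measure ℝ) [IsFiniteMeasure μ] [NullSingletonClass μ] :
    IsLittleOP P fun n ω => eLpNorm (fun x : ℝ =>
      (n : ℝ)⁻¹ * ∑ t ∈ Finset.Icc 1 n, latentCDF ξ t ω x - ∫ ω', latentCDF ξ 0 ω' x ∂P) 2 μ := by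
  have := isProbabilityMeasure_barycenter (P := P) hξ 0
  intro ε hε
  obtain ⟨m, hm⟩ := ((tendsto_eLpNorm_measureReal_closedBall
    (barycenter P (ξ 0)) μ).eventually_lt_const hε).exists
  have hc : (0 : ℝ) < 1 / ((m : ℝ) + 1) := by positivity
  refine tendsto_of_tendsto_of_tendsto_of_le_of_le' tendsto_const_nhds
    (herg (ENNReal.ofReal (1 / ((m : ℝ) + 1))) (ENNReal.ofReal_pos.2 hc))
    (Eventually.of_forall fun _ => zero_le) ?_
  -- At `n = 0` the weight `n⁻¹` is `∞` in `ℝ≥0∞`.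
  filter_upwards [eventually_ge_atTop 1] with n hn
  refine measure_mono fun ω (hω : ε ≤ _) => ?_
  by_contra hlt
  rw [Set.mem_ofPred_eq, not_le] at hlt
  refine absurd (hω.trans ?_) (not_le.2 hm)
  have hn0 : (n : ℝ≥0∞) ≠ 0 := Nat.cast_ne_zero.2 (by omega)
  have : IsFiniteMeasure ((n : ℝ≥0∞)⁻¹ • ∑ t ∈ Finset.Icc 1 n, (ξ t ω : Measure ℝ)) :=
    Measure.smul_finite _ (ENNReal.inv_ne_top.2 hn0)
  refine eLpNorm_mono_real fun x => ?_
  rw [Real.norm_eq_abs, ← barycenter_real_Iic hξ]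
  refine le_trans (le_of_eq ?_) (abs_measureReal_Iic_sub_le hc hlt x)
  rw [measureReal_ennreal_smul_apply, measureReal_def (∑ t ∈ Finset.Icc 1 n, (ξ t ω : Measure ℝ)),
    Measure.finsetSum_apply, ENNReal.toReal_sum fun _ _ => measure_ne_top _ _]
  simp [latentCDF, measureReal_def]

theorem nullSingletonClass_of_isDiffraction {μ : Measure ℝ} (hμ : IsDiffraction P ξ μ) :
    NullSingletonClass μ := by
  obtain ⟨I, -, -, h, -⟩ := hμ
  exact ⟨fun x => h (measure_singleton x)⟩

theorem integral_latentCDF_eq (hstat : IsStationary P ξ) (k : ℕ)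
    (x : ℝ) : ∫ ω, latentCDF ξ k ω x ∂P = ∫ ω, latentCDF ξ 0 ω x ∂P := by
  have h1 : Measurable fun f : ℕ → ProbabilityMeasure ℝ => (f 0 : Measure ℝ).real (Set.Iic x) :=
    (measurable_measureReal_coe measurableSet_Iic).comp (measurable_pi_apply 0)
  have h2 := ((hstat k).comp h1).integral_eq
  simpa [Function.comp_def, latentCDF] using h2

end LevyProkhorov

/-! ### Edge effects in averages: truncation and shift -/

section Averages

theorem abs_sum_Icc_sub_sum_Icc_le {f : ℕ → ℝ} (hf : ∀ t, |f t| ≤ 1) {m n : ℕ} (hmn : m ≤ n) :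
    |∑ t ∈ Finset.Icc 1 n, f t - ∑ t ∈ Finset.Icc 1 m, f t| ≤ n - m := by
  induction n, hmn using Nat.le_induction with
  | base => simp
  | succ n hmn ih =>
    rw [Finset.sum_Icc_succ_top (by omega), add_sub_right_comm]
    refine (abs_add_le _ _).trans ?_
    push_cast
    linarith [hf (n + 1)]

theorem abs_average_prefix_sub_average_le {f : ℕ → ℝ} (hf : ∀ t, |f t| ≤ 1) {p n : ℕ}
    (hpn : p < n) :
    |((n : ℝ) - p)⁻¹ * ∑ t ∈ Finset.Icc 1 (n - p), f t - (n : ℝ)⁻¹ * ∑ t ∈ Finset.Icc 1 n, f t| ≤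
      2 * (p / n) := by
  have hn : (0 : ℝ) < n := Nat.cast_pos.2 (by omega)
  have hnp : (0 : ℝ) < (n : ℝ) - p := sub_pos.2 (Nat.cast_lt.2 hpn)
  have hcast : ((n - p : ℕ) : ℝ) = n - p := Nat.cast_sub hpn.le
  have h1 := abs_sum_Icc_sub_sum_Icc_le hf (Nat.sub_le n p)
  have h2 := abs_sum_Icc_sub_sum_Icc_le hf (Nat.zero_le (n - p))
  simp only [Finset.Icc_eq_empty_of_lt zero_lt_one, Finset.sum_empty, sub_zero, hcast,
    Nat.cast_zero] at h1 h2
  set S := ∑ t ∈ Finset.Icc 1 n, f t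
  set S' := ∑ t ∈ Finset.Icc 1 (n - p), f t
  -- The first term is the cost of changing the normalization, the second that of the `p` missing
  -- summands; each is at most `p/n`.
  have h3 : ((n : ℝ) - p)⁻¹ * S' - (n : ℝ)⁻¹ * S =
      ((n : ℝ) - p)⁻¹ * S' * (p / n) - (n : ℝ)⁻¹ * (S - S') := by
    field_simp
    ring
  rw [h3]
  refine (abs_sub _ _).trans ?_
  have h4 : |((n : ℝ) - p)⁻¹ * S' * (p / n)| ≤ p / n := by
    rw [abs_mul, abs_mul, abs_of_pos (inv_pos.2 hnp),
      abs_of_nonneg (show (0 : ℝ) ≤ p / n by positivity)]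
    exact mul_le_of_le_one_left (by positivity) (by rwa [inv_mul_le_iff₀ hnp, mul_one])
  have h5 : |(n : ℝ)⁻¹ * (S - S')| ≤ p / n := by
    rw [abs_mul, abs_of_pos (inv_pos.2 hn), inv_mul_eq_div]
    gcongr
    linarith
  linarith

theorem abs_sum_shift_sub_sum_le {f : ℕ → ℝ} (hf : ∀ t, f t ∈ Set.Icc (0 : ℝ) 1) (n k : ℕ) :
    |∑ t ∈ Finset.Icc 1 n, f (t + k) - ∑ t ∈ Finset.Icc 1 n, f t| ≤ k := by
  have htel : ∀ (g : ℕ → ℝ) (n : ℕ), ∑ t ∈ Finset.Icc 1 n, g (t + 1) - ∑ t ∈ Finset.Icc 1 n, g t =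
      g (n + 1) - g 1 := by
    intro g n
    induction n with
    | zero => simp
    | succ n ih =>
      rw [Finset.sum_Icc_succ_top (by omega), Finset.sum_Icc_succ_top (by omega)]
      linarith
  induction k with
  | zero => simp
  | succ k ih =>
    have h1 := htel (fun t => f (t + k)) n
    simp only [add_assoc, add_comm 1 k] at h1
    have h2 := abs_sub_le_one_of_mem_Icc (hf (n + (k + 1))) (hf (k + 1))
    rw [abs_le] at h2 ih ⊢
    push_cast
    constructor <;> linarith [h2.1, h2.2, ih.1, ih.2]

end Averages

/-! ### Decomposition of the autocovariance error -/

section Autocovariance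

variable {Ω : Type*} {X : ℝ≥0 → Ω → ℝ} {S : SamplingScheme}

theorem empMean_mem (X : ℝ≥0 → Ω → ℝ) (S : SamplingScheme) (n : ℕ) (ω : Ω) (x : ℝ) :
    empMean X S n ω x ∈ Set.Icc (0 : ℝ) 1 :=
  ⟨mul_nonneg (by positivity) (Finset.sum_nonneg fun t _ => (empCDF_mem X S t ω x).1),
    (le_abs_self _).trans (abs_average_le_one fun t =>
      abs_le.2 ⟨by linarith [(empCDF_mem X S t ω x).1], (empCDF_mem X S t ω x).2⟩)⟩

theorem abs_empAutocov_le_one (X : ℝ≥0 → Ω → ℝ) (S : SamplingScheme) {p n : ℕ} (hpn : p < n)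
    (ω : Ω) (k : ℕ) (x y : ℝ) : |empAutocov X S p n ω k x y| ≤ 1 := by
  have h := abs_average_le_one (n := n - p) (f := fun t =>
    (empCDF X S t ω x - empMean X S n ω x) * (empCDF X S (t + k) ω y - empMean X S n ω y))
    fun t => by
      rw [abs_mul]
      exact mul_le_one₀ (abs_sub_le_one_of_mem_Icc (empCDF_mem X S t ω x) (empMean_mem X S n ω x))
        (abs_nonneg _)
        (abs_sub_le_one_of_mem_Icc (empCDF_mem X S (t + k) ω y) (empMean_mem X S n ω y))
  rwa [Nat.cast_sub hpn.le] at h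

/-- Of the error, `2p/n` comes from averaging over `n - p` instead of `n` cycles, and `p/n` from
centering the shifted factor at the unshifted mean. -/
theorem abs_empAutocov_sub_le (X : ℝ≥0 → Ω → ℝ) (S : SamplingScheme) {p n : ℕ} (hpn : p < n)
    (ω : Ω) {k : ℕ} (hk : k ≤ p) (x y : ℝ) :
    |empAutocov X S p n ω k x y -
      ((n : ℝ)⁻¹ * ∑ t ∈ Finset.Icc 1 n, empCDF X S t ω x * empCDF X S (t + k) ω y -
        empMean X S n ω x * empMean X S n ω y)| ≤ 3 * (p / n) := by
  have hn : (0 : ℝ) < n := Nat.cast_pos.2 (by omega)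
  set a := empMean X S n ω x with ha
  set b := empMean X S n ω y with hb
  have h1 := abs_average_prefix_sub_average_le (f := fun t =>
    (empCDF X S t ω x - a) * (empCDF X S (t + k) ω y - b))
    (fun t => by
      rw [abs_mul]
      exact mul_le_one₀ (abs_sub_le_one_of_mem_Icc (empCDF_mem X S t ω x) (empMean_mem X S n ω x))
        (abs_nonneg _)
        (abs_sub_le_one_of_mem_Icc (empCDF_mem X S (t + k) ω y) (empMean_mem X S n ω y))) hpn
  have h2 := abs_sum_shift_sub_sum_le (fun t => empCDF_mem X S t ω y) n k
  have h3 : |a * ((n : ℝ)⁻¹ * (∑ t ∈ Finset.Icc 1 n, empCDF X S (t + k) ω y -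
      ∑ t ∈ Finset.Icc 1 n, empCDF X S t ω y))| ≤ p / n := by
    rw [abs_mul, abs_mul, abs_of_nonneg (empMean_mem X S n ω x).1, abs_of_pos (inv_pos.2 hn)]
    refine (mul_le_of_le_one_left (by positivity) (empMean_mem X S n ω x).2).trans ?_
    rw [inv_mul_eq_div]
    have : (k : ℝ) ≤ p := Nat.cast_le.2 hk
    gcongr
    linarith
  have h4 : (n : ℝ)⁻¹ * ∑ t ∈ Finset.Icc 1 n,
      (empCDF X S t ω x - a) * (empCDF X S (t + k) ω y - b) =
      ((n : ℝ)⁻¹ * ∑ t ∈ Finset.Icc 1 n, empCDF X S t ω x * empCDF X S (t + k) ω y - a * b) -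
        a * ((n : ℝ)⁻¹ * (∑ t ∈ Finset.Icc 1 n, empCDF X S (t + k) ω y -
          ∑ t ∈ Finset.Icc 1 n, empCDF X S t ω y)) := by
    have e1 : (n : ℝ)⁻¹ * ∑ t ∈ Finset.Icc 1 n, empCDF X S t ω x = a := rfl
    have e2 : (n : ℝ)⁻¹ * ∑ t ∈ Finset.Icc 1 n, empCDF X S t ω y = b := rfl
    have e3 : (n : ℝ)⁻¹ * n = 1 := inv_mul_cancel₀ hn.ne'
    simp only [sub_mul, mul_sub, Finset.sum_sub_distrib, Finset.sum_const, Nat.card_Icc,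
      ← Finset.sum_mul, ← Finset.mul_sum, nsmul_eq_mul, Nat.add_sub_cancel]
    linear_combination (-b) * e1 - a * e2 + a * b * e3
  rw [h4] at h1
  change |empAutocov X S p n ω k x y - _| ≤ _ at h1
  set c := empAutocov X S p n ω k x y
  set u := a * ((n : ℝ)⁻¹ * (∑ t ∈ Finset.Icc 1 n, empCDF X S (t + k) ω y -
      ∑ t ∈ Finset.Icc 1 n, empCDF X S t ω y))
  rw [abs_le] at h1 h3 ⊢
  constructor <;> linarith [h1.1, h1.2, h3.1, h3.2]

variable [MeasurableSpace Ω] {P : Measure Ω} [IsProbabilityMeasure P]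
  {ξ : ℕ → Ω → ProbabilityMeasure ℝ}

theorem autocov_eq_sub (hξ : ∀ t, Measurable (ξ t)) (hstat : IsStationary P ξ) (k : ℕ) (x y : ℝ) :
    autocov P ξ k x y = ∫ ω, latentCDF ξ 0 ω x * latentCDF ξ k ω y ∂P -
      (∫ ω, latentCDF ξ 0 ω x ∂P) * ∫ ω, latentCDF ξ 0 ω y ∂P := by
  have hL : ∀ t z, MemLp (fun ω => latentCDF ξ t ω z) 2 P := fun t z =>
    MemLp.of_bound ((measurable_latentCDF hξ t).comp measurable_prodMk_right).aestronglyMeasurable 1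
      (Eventually.of_forall fun ω => by
        rw [Real.norm_eq_abs, abs_of_nonneg (latentCDF_mem ξ t ω z).1]
        exact (latentCDF_mem ξ t ω z).2)
  rw [autocov, covariance_eq_sub (hL 0 x) (hL k y), integral_latentCDF_eq hstat k y]
  rfl

theorem integral_latentCDF_mem (hξ : ∀ t, Measurable (ξ t)) (t : ℕ) (x : ℝ) :
    ∫ ω, latentCDF ξ t ω x ∂P ∈ Set.Icc (0 : ℝ) 1 := by
  have := isProbabilityMeasure_barycenter (P := P) hξ t
  rw [← barycenter_real_Iic hξ]
  exact ⟨measureReal_nonneg, measureReal_le_one⟩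

theorem abs_empAutocov_sub_autocov_le (hξ : ∀ t, Measurable (ξ t)) (hstat : IsStationary P ξ)
    (X : ℝ≥0 → Ω → ℝ) (S : SamplingScheme) {p n : ℕ} (hpn : p < n) (ω : Ω) {k : ℕ} (hk : k ≤ p)
    (x y : ℝ) :
    |empAutocov X S p n ω k x y - autocov P ξ k x y| ≤ 3 * (p / n) +
      |(n : ℝ)⁻¹ * ∑ t ∈ Finset.Icc 1 n, (empCDF X S t ω x * empCDF X S (t + k) ω y -
        latentCDF ξ t ω x * latentCDF ξ (t + k) ω y)| +
      |(n : ℝ)⁻¹ * ∑ t ∈ Finset.Icc 1 n, latentCDF ξ t ω x * latentCDF ξ (t + k) ω y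
          - ∫ ω', latentCDF ξ 0 ω' x * latentCDF ξ k ω' y ∂P| +
      |empMean X S n ω x - ∫ ω', latentCDF ξ 0 ω' x ∂P| +
      |empMean X S n ω y - ∫ ω', latentCDF ξ 0 ω' y ∂P| := by
  have h1 := abs_empAutocov_sub_le X S hpn ω hk x y
  rw [autocov_eq_sub hξ hstat, Finset.sum_sub_distrib, mul_sub]
  have ha := empMean_mem X S n ω x
  have hb := integral_latentCDF_mem (P := P) hξ 0 y
  set c := empAutocov X S p n ω k x y
  set a := empMean X S n ω x
  set a' := empMean X S n ω y
  set b := ∫ ω', latentCDF ξ 0 ω' x ∂P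
  set b' := ∫ ω', latentCDF ξ 0 ω' y ∂P
  set G := (n : ℝ)⁻¹ * ∑ t ∈ Finset.Icc 1 n, empCDF X S t ω x * empCDF X S (t + k) ω y
  set F := (n : ℝ)⁻¹ * ∑ t ∈ Finset.Icc 1 n, latentCDF ξ t ω x * latentCDF ξ (t + k) ω y
  set E := ∫ ω', latentCDF ξ 0 ω' x * latentCDF ξ k ω' y ∂P
  have h2 : |a * (a' - b')| ≤ |a' - b'| := by
    rw [abs_mul, abs_of_nonneg ha.1]
    exact mul_le_of_le_one_left (abs_nonneg _) ha.2
  have h3 : |(a - b) * b'| ≤ |a - b| := by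
    rw [abs_mul, abs_of_nonneg hb.1]
    exact mul_le_of_le_one_right (abs_nonneg _) hb.2
  have h4 : c - (E - b * b') =
      (c - (G - a * a')) + (G - F) + (F - E) - (a - b) * b' - a * (a' - b') := by ring
  rw [h4]
  refine (abs_sub _ _).trans (add_le_add ((abs_sub _ _).trans (add_le_add
    ((abs_add_le _ _).trans (add_le_add ((abs_add_le _ _).trans (add_le_add h1 le_rfl)) le_rfl))
      h3)) h2)

end Autocovariance

/-! ### Lipschitz dependence of the kernel on the autocovariances -/

section LagKernel

variable {μ : Measure ℝ} [IsFiniteMeasure μ]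

theorem eLpNorm_two_comp_fst {f : ℝ → ℝ} (hf : AEStronglyMeasurable f μ) :
    eLpNorm (fun z : ℝ × ℝ => f z.1) 2 (μ.prod μ) =
      (μ Set.univ) ^ (1 / 2 : ℝ) * eLpNorm f 2 μ := by
  have h := eLpNorm_map_measure (p := 2) (f := Prod.fst) (μ := μ.prod μ) (g := f)
    (by rw [Measure.map_fst_prod]; exact hf.smul_measure _) measurable_fst.aemeasurable
  rw [Measure.map_fst_prod, eLpNorm_smul_measure_of_ne_top ENNReal.ofNat_ne_top] at h
  simpa [Function.comp_def] using h.symm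

theorem eLpNorm_two_comp_snd {f : ℝ → ℝ} (hf : AEStronglyMeasurable f μ) :
    eLpNorm (fun z : ℝ × ℝ => f z.2) 2 (μ.prod μ) =
      (μ Set.univ) ^ (1 / 2 : ℝ) * eLpNorm f 2 μ := by
  have h := eLpNorm_map_measure (p := 2) (f := Prod.snd) (μ := μ.prod μ) (g := f)
    (by rw [Measure.map_snd_prod]; exact hf.smul_measure _) measurable_snd.aemeasurable
  rw [Measure.map_snd_prod, eLpNorm_smul_measure_of_ne_top ENNReal.ofNat_ne_top] at h
  simpa [Function.comp_def] using h.symm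

theorem abs_integral_mul_sub_integral_mul_le {C D : ℝ → ℝ → ℝ}
    (hC : Measurable (Function.uncurry C)) (hD : Measurable (Function.uncurry D))
    (hCb : ∀ x y, |C x y| ≤ 1) (hDb : ∀ x y, |D x y| ≤ 1) (x y : ℝ) :
    |∫ z, C x z * C y z ∂μ - ∫ z, D x z * D y z ∂μ| ≤
      ∫ z, |C x z - D x z| ∂μ + ∫ z, |C y z - D y z| ∂μ := by
  have hi : ∀ {K : ℝ → ℝ → ℝ}, Measurable (Function.uncurry K) → (∀ x y, |K x y| ≤ 1) →
      ∀ x, Integrable (K x) μ := fun {K} hK hKb x =>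
    Integrable.of_bound (f := K x) (hK.comp measurable_prodMk_left).aestronglyMeasurable 1
      (Eventually.of_forall (hKb x))
  have hii : ∀ {K : ℝ → ℝ → ℝ}, Measurable (Function.uncurry K) → (∀ x y, |K x y| ≤ 1) →
      ∀ x y, Integrable (fun z => K x z * K y z) μ := fun {K} hK hKb x y =>
    (hi hK hKb y).bdd_mul (hi hK hKb x).1 (c := 1) (Eventually.of_forall (hKb x))
  have hCD : ∀ x, Integrable (fun z => |C x z - D x z|) μ := fun x =>
    ((hi hC hCb x).sub (hi hD hDb x)).abs
  rw [← integral_sub (hii hC hCb x y) (hii hD hDb x y), ← integral_add (hCD x) (hCD y)]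
  rw [← Real.norm_eq_abs]
  refine norm_integral_le_of_norm_le ((hCD x).add (hCD y)) (Eventually.of_forall fun z => ?_)
  have h : C x z * C y z - D x z * D y z =
      (C x z - D x z) * C y z + D x z * (C y z - D y z) := by ring
  rw [h, Real.norm_eq_abs]
  refine (abs_add_le _ _).trans (add_le_add ?_ ?_)
  · rw [abs_mul]
    exact mul_le_of_le_one_right (abs_nonneg _) (hCb y z)
  · rw [abs_mul]
    exact mul_le_of_le_one_left (abs_nonneg _) (hDb x z)

theorem memLp_uncurry_of_abs_le_one {K : ℝ → ℝ → ℝ} (hK : Measurable (Function.uncurry K))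
    (hb : ∀ x y, |K x y| ≤ 1) : MemLp (Function.uncurry K) 2 (μ.prod μ) :=
  MemLp.of_bound hK.aestronglyMeasurable 1 (Eventually.of_forall fun z => hb z.1 z.2)

/-- Bounding one factor of each product by 1 leaves `G k x + G k y`, with `G k` the partial integral
of `|C k - D k|`. Cauchy–Schwarz for `G k` costs `μ(ℝ)^{1/2}`, viewing it as a function of two
variables costs another, and the two coordinates give the factor 2. -/
theorem hsNorm_lagKernel_sub_le (p : ℕ) {C D : ℕ → ℝ → ℝ → ℝ}
    (hC : ∀ k, Measurable (Function.uncurry (C k)))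
    (hD : ∀ k, Measurable (Function.uncurry (D k)))
    (hCb : ∀ k x y, |C k x y| ≤ 1) (hDb : ∀ k x y, |D k x y| ≤ 1) :
    hsNorm μ (fun x y => lagKernel μ p C x y - lagKernel μ p D x y) ≤
      2 * μ Set.univ * ∑ k ∈ Finset.Icc 1 p, hsNorm μ fun x y => C k x y - D k x y := by
  let K : ℕ → ℝ → ℝ → ℝ := fun k x y => |C k x y - D k x y|
  let G : ℕ → ℝ → ℝ := fun k x => ∫ z, K k x z ∂μ
  have hK : ∀ k, MemLp (Function.uncurry (K k)) 2 (μ.prod μ) := fun k =>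
    ((memLp_uncurry_of_abs_le_one (hC k) (hCb k)).sub
      (memLp_uncurry_of_abs_le_one (hD k) (hDb k))).abs
  have hone : MemLp (fun _ : ℝ => (1 : ℝ)) 2 μ := memLp_const 1
  have hKnorm : ∀ k, eLpNorm (Function.uncurry (K k)) 2 (μ.prod μ) =
      hsNorm μ fun x y => C k x y - D k x y := fun k =>
    eLpNorm_norm (Function.uncurry fun x y => C k x y - D k x y)
  have hG : ∀ k, MemLp (G k) 2 μ := fun k => by
    simpa [G] using memLp_integral_mul (hK k) hone
  have hGle : ∀ k, eLpNorm (G k) 2 μ ≤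
      (hsNorm μ fun x y => C k x y - D k x y) * (μ Set.univ) ^ (1 / 2 : ℝ) := fun k => by
    have h := eLpNorm_integral_mul_le (hK k) hone
    rw [hKnorm k] at h
    refine le_trans (le_of_eq (by simp [G])) (h.trans (le_of_eq ?_))
    rcases eq_or_ne μ 0 with rfl | hμ
    · simp
    · rw [eLpNorm_const _ two_ne_zero hμ]
      simp
  have hmeas : ∀ k, AEStronglyMeasurable (fun z : ℝ × ℝ => G k z.1 + G k z.2) (μ.prod μ) :=
    fun k => (hG k).1.comp_fst.add (hG k).1.comp_snd
  have hGG : ∀ k, eLpNorm (fun z : ℝ × ℝ => G k z.1 + G k z.2) 2 (μ.prod μ) ≤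
      2 * μ Set.univ * hsNorm μ fun x y => C k x y - D k x y := fun k => by
    refine (eLpNorm_add_le (hG k).1.comp_fst (hG k).1.comp_snd one_le_two).trans ?_
    rw [eLpNorm_two_comp_fst (hG k).1, eLpNorm_two_comp_snd (hG k).1, ← two_mul]
    refine (mul_le_mul_right (mul_le_mul_right (hGle k) _) 2).trans (le_of_eq ?_)
    generalize (hsNorm μ fun x y => C k x y - D k x y) = h
    have hsq : (μ Set.univ) ^ (1 / 2 : ℝ) * (μ Set.univ) ^ (1 / 2 : ℝ) = μ Set.univ := by
      rw [← ENNReal.rpow_add_of_nonneg _ _ (by norm_num) (by norm_num)]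
      norm_num
    calc 2 * ((μ Set.univ) ^ (1 / 2 : ℝ) * (h * (μ Set.univ) ^ (1 / 2 : ℝ)))
        = 2 * ((μ Set.univ) ^ (1 / 2 : ℝ) * (μ Set.univ) ^ (1 / 2 : ℝ)) * h := by ring
      _ = 2 * μ Set.univ * h := by rw [hsq]
  calc hsNorm μ (fun x y => lagKernel μ p C x y - lagKernel μ p D x y)
      ≤ eLpNorm (fun z => ∑ k ∈ Finset.Icc 1 p, (G k z.1 + G k z.2)) 2 (μ.prod μ) := by
        refine eLpNorm_mono_real fun z => ?_
        rw [Real.norm_eq_abs]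
        simp only [Function.uncurry, lagKernel, ← Finset.sum_sub_distrib]
        exact (Finset.abs_sum_le_sum_abs _ _).trans (Finset.sum_le_sum fun k _ =>
          abs_integral_mul_sub_integral_mul_le (hC k) (hD k) (hCb k) (hDb k) z.1 z.2)
    _ ≤ ∑ k ∈ Finset.Icc 1 p, eLpNorm (fun z => G k z.1 + G k z.2) 2 (μ.prod μ) := by
        have h := eLpNorm_sum_le (s := Finset.Icc 1 p) (p := 2) (μ := μ.prod μ)
          (f := fun k (z : ℝ × ℝ) => G k z.1 + G k z.2) (fun k _ => hmeas k) one_le_two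
        refine le_trans (le_of_eq (congrArg (fun g => eLpNorm g 2 (μ.prod μ)) ?_)) h
        ext z
        simp
    _ ≤ _ := by
        rw [Finset.mul_sum]
        exact Finset.sum_le_sum fun k _ => hGG k

end LagKernel

/-! ### Consistency of the estimators -/

section EmpiricalOperator

variable {Ω : Type*} {μ : Measure ℝ} [IsFiniteMeasure μ]

theorem isCompactOperator_empDynOp (X : ℝ≥0 → Ω → ℝ) (S : SamplingScheme) (p n : ℕ) (ω : Ω) :
    IsCompactOperator (empDynOp X S μ p n ω) :=
  isCompactOperator_integralOp _

theorem isSymmetric_empDynOp (X : ℝ≥0 → Ω → ℝ) (S : SamplingScheme) (p n : ℕ) (ω : Ω) :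
    (empDynOp X S μ p n ω : Lp ℝ 2 μ →ₗ[ℝ] Lp ℝ 2 μ).IsSymmetric :=
  isSymmetric_integralOp _ (lagKernel_comm μ p _)

end EmpiricalOperator

section Consistency

variable {Ω : Type*} [MeasurableSpace Ω] {P : Measure Ω} [IsProbabilityMeasure P]
  {ξ : ℕ → Ω → ProbabilityMeasure ℝ} {X : ℝ≥0 → Ω → ℝ} {μ : Measure ℝ} [IsFiniteMeasure μ]

theorem isLittleOP_empMean_sub (hconj : IsConjugateProcess P ξ X)
    (hcyc : IsCyclicIndependent P ξ X) (hμ : IsDiffraction P ξ μ)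
    (herg : IsErgodicInProbability P ξ) (S : SamplingScheme) :
    IsLittleOP P fun n ω => eLpNorm
      (fun x => empMean X S n ω x - ∫ ω', latentCDF ξ 0 ω' x ∂P) 2 μ := by
  have := nullSingletonClass_of_isDiffraction hμ
  have hξ := hconj.measurable_latent
  refine ((isLittleOP_average_empCDF_sub hconj hcyc S μ).add
    (isLittleOP_average_latentCDF_sub hξ herg μ)).mono (Eventually.of_forall fun n ω => ?_)
  have hF : ∀ t, Measurable fun x => latentCDF ξ t ω x := fun t =>
    (measurable_latentCDF hξ t).comp measurable_prodMk_left
  have hmean : Measurable fun x : ℝ => ∫ ω', latentCDF ξ 0 ω' x ∂P :=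
    (measurable_latentCDF hξ 0).stronglyMeasurable.integral_prod_left'.measurable
  refine le_trans (le_of_eq ?_) (eLpNorm_add_le ?_ ?_ one_le_two)
  · refine congrArg (fun g => eLpNorm g 2 μ) (funext fun x => ?_)
    simp only [Pi.add_apply, empMean, Finset.sum_sub_distrib]
    ring
  · exact ((Finset.measurable_sum _ fun t _ =>
      (measurable_empCDF X S t ω).sub (hF t)).const_mul _).aestronglyMeasurable
  · exact (((Finset.measurable_sum _ fun t _ => hF t).const_mul _).sub hmean).aestronglyMeasurable

theorem isLittleOP_hsNorm_empAutocov_sub (hconj : IsConjugateProcess P ξ X)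
    (hstat : IsStationary P ξ) (hcyc : IsCyclicIndependent P ξ X) (hμ : IsDiffraction P ξ μ)
    (herg : IsErgodicInProbability P ξ) (S : SamplingScheme) {p k : ℕ} (hk : k ∈ Finset.Icc 1 p)
    (hauto : IsLittleOP P fun n ω =>
      eLpNorm (fun z : ℝ × ℝ =>
        ((n : ℝ)⁻¹ * ∑ t ∈ Finset.Icc 1 n, latentCDF ξ t ω z.1 * latentCDF ξ (t + k) ω z.2)
          - ∫ ω', latentCDF ξ 0 ω' z.1 * latentCDF ξ k ω' z.2 ∂P) 2 (μ.prod μ)) :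
    IsLittleOP P fun n ω =>
      hsNorm μ fun x y => empAutocov X S p n ω k x y - autocov P ξ k x y := by
  have hξ := hconj.measurable_latent
  obtain ⟨hk1, hkp⟩ := Finset.mem_Icc.1 hk
  have hconst : Tendsto (fun n : ℕ => eLpNorm (fun _ : ℝ × ℝ => 3 * ((p : ℝ) / n)) 2 (μ.prod μ))
      atTop (𝓝 0) := by
    have h1 : ∀ n : ℕ, eLpNorm (fun _ : ℝ × ℝ => 3 * ((p : ℝ) / n)) 2 (μ.prod μ) =
        ‖3 * ((p : ℝ) / n)‖ₑ * (μ.prod μ) Set.univ ^ (1 / (2 : ℝ≥0∞).toReal) := fun n =>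
      eLpNorm_const' _ two_ne_zero ENNReal.ofNat_ne_top
    simp only [h1]
    have h2 : Tendsto (fun n : ℕ => 3 * ((p : ℝ) / n)) atTop (𝓝 0) := by
      simpa using (tendsto_const_div_atTop_nhds_zero_nat (p : ℝ)).const_mul 3
    have h3 := ENNReal.Tendsto.mul_const (b := (μ.prod μ) Set.univ ^ (1 / (2 : ℝ≥0∞).toReal))
      h2.enorm (Or.inr (by finiteness))
    simpa using h3
  have hc : (μ Set.univ) ^ (1 / 2 : ℝ) ≠ ∞ := by finiteness
  have hmean := (isLittleOP_empMean_sub hconj hcyc hμ herg S).const_mul hc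
  -- The mean error enters twice, once in each coordinate.
  refine (((((isLittleOP_of_tendsto hconst).add
    (isLittleOP_average_empCDF_mul_sub hconj hcyc S μ hk1)).add hauto).add hmean).add hmean).mono ?_
  filter_upwards [eventually_gt_atTop p] with n hn ω
  have hG : ∀ t, Measurable (empCDF X S t ω) := fun t => measurable_empCDF X S t ω
  have hF : ∀ t, Measurable fun x => latentCDF ξ t ω x := fun t =>
    (measurable_latentCDF hξ t).comp measurable_prodMk_left
  have hEm : Measurable fun x : ℝ => ∫ ω', latentCDF ξ 0 ω' x ∂P :=
    (measurable_latentCDF hξ 0).stronglyMeasurable.integral_prod_left'.measurable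
  have hEE : Measurable fun z : ℝ × ℝ => ∫ ω', latentCDF ξ 0 ω' z.1 * latentCDF ξ k ω' z.2 ∂P :=
    (((measurable_latentCDF hξ 0).comp
      (measurable_fst.prodMk (measurable_fst.comp measurable_snd) :
        Measurable fun u : Ω × ℝ × ℝ => (u.1, u.2.1))).mul
      ((measurable_latentCDF hξ k).comp
      (measurable_fst.prodMk (measurable_snd.comp measurable_snd) :
        Measurable fun u : Ω × ℝ × ℝ => (u.1, u.2.2)))).stronglyMeasurable.integral_prod_left'
          |>.measurable
  let e : ℝ → ℝ := fun x => empMean X S n ω x - ∫ ω', latentCDF ξ 0 ω' x ∂P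
  have he : AEStronglyMeasurable e μ := ((measurable_empMean X S n ω).sub hEm).aestronglyMeasurable
  let a : ℝ × ℝ → ℝ := fun _ => 3 * ((p : ℝ) / n)
  let b : ℝ × ℝ → ℝ := fun z =>
    (n : ℝ)⁻¹ * ∑ t ∈ Finset.Icc 1 n, (empCDF X S t ω z.1 * empCDF X S (t + k) ω z.2 -
      latentCDF ξ t ω z.1 * latentCDF ξ (t + k) ω z.2)
  let c : ℝ × ℝ → ℝ := fun z =>
    ((n : ℝ)⁻¹ * ∑ t ∈ Finset.Icc 1 n, latentCDF ξ t ω z.1 * latentCDF ξ (t + k) ω z.2)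
          - ∫ ω', latentCDF ξ 0 ω' z.1 * latentCDF ξ k ω' z.2 ∂P
  have hFF : ∀ t, Measurable fun z : ℝ × ℝ => latentCDF ξ t ω z.1 * latentCDF ξ (t + k) ω z.2 :=
    fun t => ((hF t).comp measurable_fst).mul ((hF (t + k)).comp measurable_snd)
  have ha' : AEStronglyMeasurable a (μ.prod μ) := aestronglyMeasurable_const
  have hb' : AEStronglyMeasurable (fun z => ‖b z‖) (μ.prod μ) :=
    ((Finset.measurable_sum _ fun t _ => (((hG t).comp measurable_fst).mul
      ((hG (t + k)).comp measurable_snd)).sub (hFF t)).const_mul _).aestronglyMeasurable.norm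
  have hc' : AEStronglyMeasurable (fun z => ‖c z‖) (μ.prod μ) :=
    (((Finset.measurable_sum _ fun t _ => hFF t).const_mul _).sub hEE).aestronglyMeasurable.norm
  have hd' : AEStronglyMeasurable (fun z : ℝ × ℝ => ‖e z.1‖) (μ.prod μ) := he.norm.comp_fst
  have he' : AEStronglyMeasurable (fun z : ℝ × ℝ => ‖e z.2‖) (μ.prod μ) := he.norm.comp_snd
  calc hsNorm μ (fun x y => empAutocov X S p n ω k x y - autocov P ξ k x y)
      ≤ eLpNorm ((((a + fun z => ‖b z‖) + fun z => ‖c z‖) + fun z => ‖e z.1‖) + fun z => ‖e z.2‖)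
          2 (μ.prod μ) :=
        eLpNorm_mono_real fun z =>
          abs_empAutocov_sub_autocov_le hξ hstat X S hn ω hkp z.1 z.2
    _ ≤ eLpNorm a 2 (μ.prod μ) + eLpNorm (fun z => ‖b z‖) 2 (μ.prod μ) +
          eLpNorm (fun z => ‖c z‖) 2 (μ.prod μ) + eLpNorm (fun z => ‖e z.1‖) 2 (μ.prod μ) +
          eLpNorm (fun z => ‖e z.2‖) 2 (μ.prod μ) := by
        refine (eLpNorm_add_le (((ha'.add hb').add hc').add hd') he' one_le_two).trans ?_
        gcongr
        refine (eLpNorm_add_le ((ha'.add hb').add hc') hd' one_le_two).trans ?_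
        gcongr
        refine (eLpNorm_add_le (ha'.add hb') hc' one_le_two).trans ?_
        gcongr
        exact eLpNorm_add_le ha' hb' one_le_two
    _ = _ := by
        rw [eLpNorm_norm, eLpNorm_norm, eLpNorm_two_comp_fst he.norm, eLpNorm_two_comp_snd he.norm,
          eLpNorm_norm]

theorem isLittleOP_hsNorm_lagKernel_sub (hconj : IsConjugateProcess P ξ X)
    (hstat : IsStationary P ξ) (hcyc : IsCyclicIndependent P ξ X) (hμ : IsDiffraction P ξ μ)
    (herg : IsErgodicInProbability P ξ) (S : SamplingScheme) {p : ℕ}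
    (hauto : ∀ k ∈ Finset.Icc 1 p, IsLittleOP P fun n ω =>
      eLpNorm (fun z : ℝ × ℝ =>
        ((n : ℝ)⁻¹ * ∑ t ∈ Finset.Icc 1 n, latentCDF ξ t ω z.1 * latentCDF ξ (t + k) ω z.2)
          - ∫ ω', latentCDF ξ 0 ω' z.1 * latentCDF ξ k ω' z.2 ∂P) 2 (μ.prod μ)) :
    IsLittleOP P (fun n ω => hsNorm μ fun x y =>
      lagKernel μ p (empAutocov X S p n ω) x y - lagKernel μ p (autocov P ξ) x y) := by
  refine ((isLittleOP_finsetSum fun k hk => isLittleOP_hsNorm_empAutocov_sub hconj hstat hcyc hμ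
    herg S hk (hauto k hk)).const_mul (c := 2 * μ Set.univ) (by finiteness)).mono ?_
  filter_upwards [eventually_gt_atTop p] with n hn ω
  exact hsNorm_lagKernel_sub_le p (fun k => measurable_empAutocov X S p n ω k)
    (measurable_autocov P hconj.measurable_latent) (fun k => abs_empAutocov_le_one X S hn ω k)
    (fun k => abs_autocov_le P k)

theorem isCompactOperator_dynOp (hξ : ∀ t, Measurable (ξ t)) (p : ℕ) :
    IsCompactOperator (dynOp P hξ μ p) :=
  isCompactOperator_integralOp _

theorem isSymmetric_dynOp (hξ : ∀ t, Measurable (ξ t)) (p : ℕ) :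
    (dynOp P hξ μ p : Lp ℝ 2 μ →ₗ[ℝ] Lp ℝ 2 μ).IsSymmetric :=
  isSymmetric_integralOp _ (lagKernel_comm μ p _)

theorem ofReal_norm_empDynOp_sub_dynOp_le (hξ : ∀ t, Measurable (ξ t)) (X : ℝ≥0 → Ω → ℝ)
    (S : SamplingScheme) (p n : ℕ) (ω : Ω) :
    ENNReal.ofReal ‖empDynOp X S μ p n ω - dynOp P hξ μ p‖ ≤
      hsNorm μ fun x y =>
        lagKernel μ p (empAutocov X S p n ω) x y - lagKernel μ p (autocov P ξ) x y :=
  (ENNReal.ofReal_le_ofReal (norm_integralOp_sub_le _ _)).trans ENNReal.ofReal_toReal_le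

end Consistency

end ConjugateProcess

/-! ### The main theorem -/

open ConjugateProcess in
theorem mainTheorem5 {Ω : Type*} [MeasurableSpace Ω] (P : Measure Ω) [IsProbabilityMeasure P]
    (ξ : ℕ → Ω → ProbabilityMeasure ℝ) (X : ℝ≥0 → Ω → ℝ)
    (hconj : IsConjugateProcess P ξ X) (hstat : IsStationary P ξ)
    (hcyc : IsCyclicIndependent P ξ X)
    (μ : Measure ℝ) [IsFiniteMeasure μ] (hμ : IsDiffraction P ξ μ)
    (herg : IsErgodicInProbability P ξ)
    (S : SamplingScheme) (p : ℕ) (hp : 1 ≤ p)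
    (hauto : ∀ k ∈ Finset.Icc 1 p, IsLittleOP P fun n ω =>
      eLpNorm (fun z : ℝ × ℝ =>
        ((n : ℝ)⁻¹ * ∑ t ∈ Finset.Icc 1 n, latentCDF ξ t ω z.1 * latentCDF ξ (t + k) ω z.2)
          - ∫ ω', latentCDF ξ 0 ω' z.1 * latentCDF ξ k ω' z.2 ∂P) 2 (μ.prod μ)) :
    IsLittleOP P (fun n ω => hsNorm μ fun x y =>
      lagKernel μ p (empAutocov X S p n ω) x y - lagKernel μ p (autocov P ξ) x y) ∧
    IsLittleOP P (fun n ω => ⨆ j : ℕ,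
      ‖eigenvalueSeq (empDynOp X S μ p n ω) j
        - eigenvalueSeq (dynOp P hconj.measurable_latent μ p) j‖ₑ) ∧
    ((∀ i j : ℕ, i ≠ j → 0 < eigenvalueSeq (dynOp P hconj.measurable_latent μ p) i →
        eigenvalueSeq (dynOp P hconj.measurable_latent μ p) i
          ≠ eigenvalueSeq (dynOp P hconj.measurable_latent μ p) j) →
      ∀ (ψ : ℕ → Lp ℝ 2 μ) (ψhat : ℕ → Ω → ℕ → Lp ℝ 2 μ),
        IsEigenSystem (dynOp P hconj.measurable_latent μ p) ψ →
        (∀ n, p < n → ∀ ω, IsEigenSystem (empDynOp X S μ p n ω) (ψhat n ω)) →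
        ∀ j : ℕ, 0 < eigenvalueSeq (dynOp P hconj.measurable_latent μ p) j →
          (∀ n, p < n → ∀ ω, 0 ≤ inner ℝ (ψhat n ω j) (ψ j)) →
          IsLittleOP P (fun n ω => ‖ψhat n ω j - ψ j‖ₑ)) := by
  have hξ := hconj.measurable_latent
  have hR := isLittleOP_hsNorm_lagKernel_sub hconj hstat hcyc hμ herg S hauto
  have hT := isCompactOperator_dynOp (P := P) (μ := μ) hξ p
  have hTs := isSymmetric_dynOp (P := P) (μ := μ) hξ p
  have hA := fun n ω => isCompactOperator_empDynOp (μ := μ) X S p n ω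
  have hAs := fun n ω => isSymmetric_empDynOp (μ := μ) X S p n ω
  refine ⟨hR, hR.mono (Eventually.of_forall fun n ω => iSup_le fun j => ?_), ?_⟩
  · rw [← ofReal_norm, Real.norm_eq_abs]
    exact (ENNReal.ofReal_le_ofReal (abs_eigenvalueSeq_sub_le (hA n ω) (hAs n ω) hT hTs j)).trans
      (ofReal_norm_empDynOp_sub_dynOp_le hξ X S p n ω)
  · intro hsimple ψ ψhat hψ hψhat j hj hsign
    -- `C` is chosen before `n` and `ω`, so the bound below is a fixed multiple of the quantity in
    -- (i).
    obtain ⟨C, hC⟩ := exists_norm_sub_le_mul_norm_sub hT hTs hψ hj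
      fun i hij => hsimple j i hij hj
    refine (hR.const_mul (c := C) ENNReal.coe_ne_top).mono ?_
    filter_upwards [eventually_gt_atTop p] with n hn ω
    rw [← ofReal_norm]
    refine (ENNReal.ofReal_le_ofReal
      (hC _ (hA n ω) (hAs n ω) _ (hψhat n hn ω) (hsign n hn ω))).trans ?_
    rw [ENNReal.ofReal_mul C.coe_nonneg, ENNReal.ofReal_coe_nnreal]
    exact mul_le_mul_right (ofReal_norm_empDynOp_sub_dynOp_le hξ X S p n ω) _
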